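/- Fix $n\ge 1$, $0<\alpha<n$, $1<p<q<\infty$ and $\delta>0$, with conjugate exponents $p'=p/(p-1)$, $q'=q/(q-1)$. A cube is a half-open cube in $\mathbb R^n$ with sides parallel to the axes and side length $\ell(Q)>0$; $|E|$ is Lebesgue measure. A weight is a non-negative locally integrable function $w$ on $\mathbb R^n$, and $w(E)=\int_E w\,dx$. For a cube $Q$, a function $f$ and $1<r<\infty$ let $$\|f\|_{r,Q}=\Big(\frac1{|Q|}\int_Q|f|^r\,dx\Big)^{1/r},\qquad \|f\|_{\Phi,Q}=\inf\Big\{\lambda>0:\ \frac1{|Q|}\int_Q\Phi\Big(\frac{|f(x)|}{\lambda}\Big)\,dx\le 1\Big\},$$ where $\Phi:[0,\infty)\to[0,\infty)$ and $\inf\varnothing=\infty$. A dyadic grid is a countable collection $\mathscr D$ of cubes such that each $Q\in\mathscr D$ has side length $2^k$ for some $k\in\mathbb Z$; $Q\cap P\in\{\varnothing,P,Q\}$ for all $Q,P\in\mathscr D$; and for each $k\in\mathbb Z$ the cubes of $\mathscr D$ of side length $2^k$ form a partition of $\mathbb R^n$. A subset $\mathcal S\subseteq\mathscr D$ is sparse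 if $\big|\bigcup_{Q'\in\mathcal S,\,Q'\subsetneq Q}Q'\big|\le\frac12|Q|$ for every $Q\in\mathcal S$. For $R\in\mathscr D$ and $f\ge0$ let $$I_\alpha^{\mathcal S(R)}f(x)=\sum_{Q\in\mathcal S,\ Q\subseteq R}|Q|^{\alpha/n}\Big(\frac1{|Q|}\int_Q f\,dy\Big)\chi_Q(x),$$ and for weights $v,w$ and exponents $1<r\le s<\infty$ let $$[v,w]^{\mathscr D}_{(I_\alpha^{\mathcal S})^{r,s}}=\sup_{R\in\mathscr D}\ w(R)^{-1/r}\Big(\int_R \big(I_\alpha^{\mathcal S(R)}(\chi_R w)\big)^s\,v\,dx\Big)^{1/s},$$ with the convention that the quantity is $0$ when $w(R)=0$. In products of norms below, $0\cdot\infty=0$. (1) If $\frac{p'}{q'}\left(1-\frac\alpha n\right)\ge1$, then there is a constant $C<\infty$, depending only on $n,\alpha,p,q,\delta$, such that for $\Phi(t)=t^q\log(e+t)^{q-1+\delta}$ and every pair of weights $(u,\sigma)$ with $$K=\sup_Q|Q|^{\frac\alpha n+\frac1q-\frac1p}\,\|u^{1/q}\|_{\Phi,Q}\,\|\sigma^{1/p'}\|_{p',Q}<\infty$$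 (supremum over all cubes $Q$), for every dyadic grid $\mathscr D$ and every sparse subset $\mathcal S\subseteq\mathscr D$, $$[\sigma,u]^{\mathscr D}_{(I_\alpha^{\mathcal S})^{q',p'}}\le C\,K .$$ (2) If $\frac qp\left(1-\frac\alpha n\right)\ge1$, then there is a constant $C<\infty$, depending only on $n,\alpha,p,q,\delta$, such that for $\Psi(t)=t^{p'}\log(e+t)^{p'-1+\delta}$ and every pair of weights $(u,\sigma)$ with $$K=\sup_Q|Q|^{\frac\alpha n+\frac1q-\frac1p}\,\|u^{1/q}\|_{q,Q}\,\|\sigma^{1/p'}\|_{\Psi,Q}<\infty,$$ for every dyadic grid $\mathscr D$ and every sparse subset $\mathcal S\subseteq\mathscr D$, $$[u,\sigma]^{\mathscr D}_{(I_\alpha^{\mathcal S})^{p,q}}\le C\,K .$$ -/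

import Mathlib

open MeasureTheory Set
open scoped ENNReal NNReal

noncomputable section

/-- A weight on `ℝⁿ`: a non-negative, locally integrable function. The space `Fin n → ℝ` carries
Lebesgue measure and the usual topology; its norm plays no role here. -/
def IsWeight {n : ℕ} (w : (Fin n → ℝ) → ℝ) : Prop :=
  (∀ x, 0 ≤ w x) ∧ LocallyIntegrable w volume

/-- The half-open cube with sides parallel to the axes, lower corner `a` and side length `l`. -/
def cube {n : ℕ} (a : Fin n → ℝ) (l : ℝ) : Set (Fin n → ℝ) :=
  {x | ∀ i, x i ∈ Ico (a i) (a i + l)}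

def IsCube {n : ℕ} (Q : Set (Fin n → ℝ)) : Prop :=
  ∃ (a : Fin n → ℝ) (l : ℝ), 0 < l ∧ Q = cube a l

/-- A dyadic grid: a countable collection of cubes of side lengths `2 ^ k`, `k ∈ ℤ`, any two of
them nested or disjoint, such that the cubes of side length `2 ^ k` partition `ℝⁿ`, for each `k`. -/
structure IsDyadicGrid {n : ℕ} (D : Set (Set (Fin n → ℝ))) : Prop where
  countable : D.Countable
  side : ∀ Q ∈ D, ∃ (k : ℤ) (a : Fin n → ℝ), Q = cube a ((2 : ℝ) ^ k)
  nested : ∀ Q ∈ D, ∀ P ∈ D, Q ∩ P = ∅ ∨ Q ∩ P = P ∨ Q ∩ P = Q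
  partition : ∀ k : ℤ,
    Setoid.IsPartition {Q | Q ∈ D ∧ ∃ a : Fin n → ℝ, Q = cube a ((2 : ℝ) ^ k)}

/-- `S` is a sparse subset of the grid `D`. -/
def IsSparseSubset {n : ℕ} (D S : Set (Set (Fin n → ℝ))) : Prop :=
  S ⊆ D ∧ ∀ Q ∈ S, volume (⋃₀ {Q' | Q' ∈ S ∧ Q' ⊂ Q}) ≤ 2⁻¹ * volume Q

/-- The average `|Q|⁻¹ ∫_Q f` of a non-negative function `f` over `Q`. -/
def cubeAvg {n : ℕ} (f : (Fin n → ℝ) → ℝ≥0∞) (Q : Set (Fin n → ℝ)) : ℝ≥0∞ :=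
  (volume Q)⁻¹ * ∫⁻ x in Q, f x

/-- The Riesz potential `∑_{Q ∈ S} |Q|^{α/n} (⨍_Q f) χ_Q(x)` over a family `S` of cubes,
for non-negative `f`. -/
def dyadicRiesz {n : ℕ} (α : ℝ) (S : Set (Set (Fin n → ℝ))) (f : (Fin n → ℝ) → ℝ≥0∞)
    (x : Fin n → ℝ) : ℝ≥0∞ :=
  ∑' Q : S, (Q : Set (Fin n → ℝ)).indicator
    (fun _ => volume (Q : Set (Fin n → ℝ)) ^ (α / n) * cubeAvg f Q) x

/-- The testing constant `[u, σ]` with exponents `p, q` for the grid `D` and the family `S`: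
`sup_{R ∈ D} σ(R)^{-1/p} (∫_R (I_α^{S(R)}(χ_R σ))^q u)^{1/q}`, where `S(R)` consists of the cubes
of `S` contained in `R`. If `σ(R) = 0`, the integral vanishes and the product is `∞ * 0 = 0`. -/
def testingConst {n : ℕ} (α : ℝ) (D S : Set (Set (Fin n → ℝ))) (u σ : (Fin n → ℝ) → ℝ)
    (p q : ℝ) : ℝ≥0∞ :=
  ⨆ R ∈ D, (∫⁻ x in R, ENNReal.ofReal (σ x)) ^ (-(1 / p)) *
    (∫⁻ x in R, dyadicRiesz α {Q | Q ∈ S ∧ Q ⊆ R}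
        (R.indicator fun y => ENNReal.ofReal (σ y)) x ^ q * ENNReal.ofReal (u x)) ^ (1 / q)

/-- The localized Luxemburg norm of `f` on `Q`; it is `∞` if no `l` is admissible. -/
def luxemburgNorm {n : ℕ} (Φ : ℝ → ℝ) (f : (Fin n → ℝ) → ℝ) (Q : Set (Fin n → ℝ)) : ℝ≥0∞ :=
  ⨅ (l : ℝ) (_ : 0 < l) (_ : cubeAvg (fun x => ENNReal.ofReal (Φ (|f x| / l))) Q ≤ 1), ENNReal.ofReal l

/-- The localized (averaged) `L^r` norm of `f` on `Q`. -/
def avgNorm {n : ℕ} (r : ℝ) (f : (Fin n → ℝ) → ℝ) (Q : Set (Fin n → ℝ)) : ℝ≥0∞ :=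
  cubeAvg (fun x => ENNReal.ofReal |f x| ^ r) Q ^ (1 / r)

/-- The log bump `t ^ r * log (e + t) ^ s`. -/
def logBump (r s t : ℝ) : ℝ := t ^ r * Real.log (Real.exp 1 + t) ^ s

/-- `sup_Q |Q|^{α/n + 1/q - 1/p} ‖u^{1/q}‖_{Φ,Q} ‖σ^{1/p'}‖_{p',Q}`, over all cubes `Q`, with
`Φ(t) = t^q log(e+t)^{q-1+δ}`. -/
def bumpLeft {n : ℕ} (α p q p' δ : ℝ) (u σ : (Fin n → ℝ) → ℝ) : ℝ≥0∞ :=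
  ⨆ (Q : Set (Fin n → ℝ)) (_ : IsCube Q), volume Q ^ (α / n + 1 / q - 1 / p) *
    luxemburgNorm (logBump q (q - 1 + δ)) (fun x => u x ^ (1 / q)) Q *
    avgNorm p' (fun x => σ x ^ (1 / p')) Q

/-- `sup_Q |Q|^{α/n + 1/q - 1/p} ‖u^{1/q}‖_{q,Q} ‖σ^{1/p'}‖_{Ψ,Q}`, over all cubes `Q`, with
`Ψ(t) = t^{p'} log(e+t)^{p'-1+δ}`. -/
def bumpRight {n : ℕ} (α p q p' δ : ℝ) (u σ : (Fin n → ℝ) → ℝ) : ℝ≥0∞ :=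
  ⨆ (Q : Set (Fin n → ℝ)) (_ : IsCube Q), volume Q ^ (α / n + 1 / q - 1 / p) *
    avgNorm q (fun x => u x ^ (1 / q)) Q *
    luxemburgNorm (logBump p' (p' - 1 + δ)) (fun x => σ x ^ (1 / p')) Q

end

/-! Part (1) is part (2) with (p, q, u, σ) replaced by (q', p', σ, u). For part (2) fix R and put
a_Q = |Q|^{α/n-1} σ(Q), A_Q = |Q|^{α/n-1} u(Q)^{1/q} σ(Q)^{1/p'}, β = (q/p)(1-α/n). A single cube
contributes a_Q^q u(Q) = A_Q^q σ(Q)^{q/p} = A_Q^q a_Q^{q/p} |Q|^β.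

Embedding (`IsSparseTree.lintegral_tsum_rpow_le`): split the cubes by A_Q ≈ 2^{-m} K, then by a_Q ≈
2^b. On one class the contribution is a fixed multiple of |Q|^β up to constants. As β ≥ 1 and
sparseness halves Lebesgue measure from layer to layer, the sum over layer k decays like 2^{-k}. For
fixed m and k a point lies in at most one cube for each b, so the sum of the a_Q there is lacunary
and its q-th power is at most a constant times the sum of the a_Q^q. Minkowski in (m, k) leaves the
sum over m of (∑ a_Q^q u(Q))^{1/q}, taken over the cubes of level m.

Carleson estimate (`IsSparseTree.tsum_measure_le`): at level m the bump condition bounds the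
Luxemburg norm of σ^{1/p'} by about 2^m times its averaged L^{p'} norm. Hence σ is absolutely
continuous on these cubes, with a loss that costs j ≲ 2^{mp'/γ} layers, γ = p'-1+δ, and ∑ σ(Q) ≲ j
σ(R). Since q/p ≥ 1, level m contributes at most a constant times K σ(R)^{1/p} 2^{-m} 2^{mp'/(γq)}.
This is summable because p' = (p'-1)p < γq. -/

/-! ### Minkowski's inequality, lacunary sums and power sums. -/

/-- Minkowski's inequality for finite sums. -/
theorem lintegral_Lp_finset_sum_le {X ι : Type*} [MeasurableSpace X] {μ : Measure X} {p : ℝ}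
    (hp : 1 ≤ p) {f : ι → X → ℝ≥0∞} (hf : ∀ i, AEMeasurable (f i) μ) (s : Finset ι) :
    (∫⁻ x, (∑ i ∈ s, f i x) ^ p ∂μ) ^ (1 / p) ≤ ∑ i ∈ s, (∫⁻ x, f i x ^ p ∂μ) ^ (1 / p) := by
  classical
  have hp0 : 0 < p := by linarith
  induction s using Finset.induction_on with
  | empty => simp [ENNReal.zero_rpow_of_pos hp0, ENNReal.zero_rpow_of_pos (inv_pos.2 hp0)]
  | insert i s hi ih =>
    simp only [Finset.sum_insert hi]
    refine le_trans ?_ (add_le_add_right ih _)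
    exact ENNReal.lintegral_Lp_add_le (hf i) (Finset.aemeasurable_fun_sum s fun i _ => hf i) hp

/-- Minkowski's inequality for countable sums. -/
theorem lintegral_Lp_tsum_le {X ι : Type*} [Countable ι] [MeasurableSpace X] {μ : Measure X}
    {p : ℝ} (hp : 1 ≤ p) {f : ι → X → ℝ≥0∞} (hf : ∀ i, AEMeasurable (f i) μ) :
    (∫⁻ x, (∑' i, f i x) ^ p ∂μ) ^ (1 / p) ≤ ∑' i, (∫⁻ x, f i x ^ p ∂μ) ^ (1 / p) := by
  have hp0 : 0 < p := by linarith
  have h1 : ∀ x, (∑' i, f i x) ^ p = ⨆ s : Finset ι, (∑ i ∈ s, f i x) ^ p := fun x => by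
    rw [ENNReal.tsum_eq_iSup_sum]
    exact (ENNReal.orderIsoRpow p hp0).map_iSup _
  simp_rw [h1]
  rw [lintegral_iSup_directed]
  · rw [one_div, ENNReal.rpow_inv_le_iff hp0]
    refine iSup_le fun s => ?_
    rw [← ENNReal.rpow_inv_le_iff hp0, ← one_div]
    exact (lintegral_Lp_finset_sum_le hp hf s).trans (ENNReal.sum_le_tsum s)
  · exact fun s => (Finset.aemeasurable_fun_sum s fun i _ => hf i).pow_const p
  · refine Monotone.directed_le fun s t hst x => ?_
    exact ENNReal.rpow_le_rpow (Finset.sum_le_sum_of_subset hst) hp0.le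

theorem sum_two_zpow_le {ι : Type*} (s : Finset ι) (b : ι → ℤ) (hb : (s : Set ι).InjOn b) (B : ℤ)
    (hB : ∀ i ∈ s, b i ≤ B) : ∑ i ∈ s, (2 : ℝ≥0∞) ^ b i ≤ 2 * 2 ^ B := by
  have h2 : (2 : ℝ≥0∞) ≠ 0 := by norm_num
  have h3 : (2 : ℝ≥0∞) ≠ ∞ := by norm_num
  have hinj : (s : Set ι).InjOn fun i => (B - b i).toNat := by
    intro i hi j hj hij
    have := hB i hi
    have := hB j hj
    apply hb hi hj
    simp only at hij
    omega
  calc ∑ i ∈ s, (2 : ℝ≥0∞) ^ b i = ∑ i ∈ s, 2 ^ B * (2⁻¹ : ℝ≥0∞) ^ (B - b i).toNat := by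
        refine Finset.sum_congr rfl fun i hi => ?_
        have := hB i hi
        rw [← ENNReal.inv_pow, ← zpow_natCast, Int.toNat_of_nonneg (by omega), ← ENNReal.zpow_neg,
          ← ENNReal.zpow_add h2 h3]
        congr 1
        ring
    _ = 2 ^ B * ∑ k ∈ s.image fun i => (B - b i).toNat, (2⁻¹ : ℝ≥0∞) ^ k := by
        rw [Finset.mul_sum, Finset.sum_image hinj]
    _ ≤ 2 ^ B * ∑' k : ℕ, (2⁻¹ : ℝ≥0∞) ^ k := by gcongr; exact ENNReal.sum_le_tsum _
    _ = 2 * 2 ^ B := by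
        rw [ENNReal.tsum_geometric, ENNReal.one_sub_inv_two, inv_inv, mul_comm]

/-- For a lacunary family the sum is comparable with its largest term. -/
theorem rpow_tsum_le_of_lacunary {ι : Type*} {q : ℝ} (hq : 0 < q) (f : ι → ℝ≥0∞) (b : ι → ℤ)
    (hb : (Function.support f).InjOn b) (h1 : ∀ i ∈ Function.support f, 2 ^ b i ≤ f i)
    (h2 : ∀ i ∈ Function.support f, f i ≤ 2 * 2 ^ b i) :
    (∑' i, f i) ^ q ≤ 4 ^ q * ∑' i, f i ^ q := by
  classical
  have key : ∑' i, f i ≤ 4 * (∑' i, f i ^ q) ^ (q⁻¹) := by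
    rw [ENNReal.tsum_eq_iSup_sum]
    refine iSup_le fun s => ?_
    rw [← Finset.sum_filter_ne_zero]
    set t := s.filter fun i => f i ≠ 0 with ht
    rcases t.eq_empty_or_nonempty with h0 | h0
    · simp [h0]
    obtain ⟨i, hi, hmax⟩ := t.exists_max_image b h0
    have hsub : ∀ j ∈ t, j ∈ Function.support f := fun j hj => (Finset.mem_filter.1 hj).2
    calc ∑ j ∈ t, f j ≤ ∑ j ∈ t, 2 * 2 ^ b j := Finset.sum_le_sum fun j hj => h2 j (hsub j hj)
      _ = 2 * ∑ j ∈ t, 2 ^ b j := by rw [Finset.mul_sum]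
      _ ≤ 2 * (2 * 2 ^ b i) := by
        gcongr
        exact sum_two_zpow_le t b (hb.mono hsub) _ hmax
      _ = 4 * 2 ^ b i := by rw [← mul_assoc]; norm_num
      _ ≤ 4 * f i := by gcongr; exact h1 i (hsub i hi)
      _ ≤ _ := by
        gcongr
        rw [ENNReal.le_rpow_inv_iff hq]
        exact ENNReal.le_tsum i
  calc (∑' i, f i) ^ q ≤ (4 * (∑' i, f i ^ q) ^ (q⁻¹)) ^ q := ENNReal.rpow_le_rpow key hq.le
    _ = _ := by rw [ENNReal.mul_rpow_of_nonneg _ _ hq.le, ENNReal.rpow_inv_rpow hq.ne']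

theorem tsum_rpow_le_rpow_tsum {ι : Type*} {r : ℝ} (hr : 1 ≤ r) (f : ι → ℝ≥0∞) :
    ∑' i, f i ^ r ≤ (∑' i, f i) ^ r := by
  have hr0 : 0 ≤ r - 1 := by linarith
  have h : ∀ y : ℝ≥0∞, y ^ r = y ^ (r - 1) * y := fun y => by
    conv_rhs => rw [← ENNReal.rpow_one y, ← ENNReal.rpow_mul, one_mul,
      ← ENNReal.rpow_add_of_nonneg _ _ hr0 zero_le_one, sub_add_cancel]
  calc ∑' i, f i ^ r ≤ ∑' i, (∑' j, f j) ^ (r - 1) * f i := by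
        refine ENNReal.tsum_le_tsum fun i => ?_
        rw [h]
        gcongr
        exact ENNReal.le_tsum i
    _ = _ := by rw [ENNReal.tsum_mul_left, ← h]

/-! ### Sparse trees, their layers and Carleson sums. -/

/-- A countable family of nested measurable sets, in which every set has finitely many ancestors
and its proper descendants cover at most half of it. -/
structure IsSparseTree {X : Type*} [MeasurableSpace X] (μ : Measure X) (T : Set (Set X)) :
    Prop where
  countable : T.Countable
  measurable : ∀ Q ∈ T, MeasurableSet Q
  nonempty : ∀ Q ∈ T, Q.Nonempty
  nested : ∀ Q ∈ T, ∀ P ∈ T, Disjoint Q P ∨ Q ⊆ P ∨ P ⊆ Q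
  finite_ancestors : ∀ Q ∈ T, {P | P ∈ T ∧ Q ⊂ P}.Finite
  sparse : ∀ Q ∈ T, μ (⋃₀ {P | P ∈ T ∧ P ⊂ Q}) ≤ 2⁻¹ * μ Q

/-- The sets of the family `T` with exactly `k` ancestors in `T`. -/
def layer {X : Type*} (T : Set (Set X)) (k : ℕ) : Set (Set X) :=
  {Q | Q ∈ T ∧ {P | P ∈ T ∧ Q ⊂ P}.ncard = k}

theorem layer_subset {X : Type*} (T : Set (Set X)) (k : ℕ) : layer T k ⊆ T := fun _ h => h.1

theorem tsum_le_tsum_layer {X : Type*} {T : Set (Set X)} (f : Set X → ℝ≥0∞) :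
    ∑' Q : T, f Q ≤ ∑' k, ∑' Q : layer T k, f Q := by
  refine le_trans (ENNReal.tsum_mono_subtype f ?_) (ENNReal.tsum_iUnion_le_tsum f _)
  exact fun Q hQ => mem_iUnion.2 ⟨_, hQ, rfl⟩

namespace IsSparseTree

variable {X : Type*} [MeasurableSpace X] {μ : Measure X} {T : Set (Set X)}

theorem mono (hT : IsSparseTree μ T) {C : Set (Set X)} (hC : C ⊆ T) : IsSparseTree μ C where
  countable := hT.countable.mono hC
  measurable Q hQ := hT.measurable Q (hC hQ)
  nonempty Q hQ := hT.nonempty Q (hC hQ)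
  nested Q hQ P hP := hT.nested Q (hC hQ) P (hC hP)
  finite_ancestors Q hQ := (hT.finite_ancestors Q (hC hQ)).subset fun _ h => ⟨hC h.1, h.2⟩
  sparse Q hQ := by
    refine (measure_mono (sUnion_subset_sUnion ?_)).trans (hT.sparse Q (hC hQ))
    exact fun _ h => ⟨hC h.1, h.2⟩

theorem ncard_lt (hT : IsSparseTree μ T) {Q P : Set X} (hQ : Q ∈ T) (hP : P ∈ T) (h : Q ⊂ P) :
    {R | R ∈ T ∧ P ⊂ R}.ncard < {R | R ∈ T ∧ Q ⊂ R}.ncard := by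
  refine ncard_lt_ncard ?_ (hT.finite_ancestors Q hQ)
  refine ⟨fun R hR => ⟨hR.1, h.trans hR.2⟩, fun hsub => ?_⟩
  exact (hsub (show P ∈ {R | R ∈ T ∧ Q ⊂ R} from ⟨hP, h⟩)).2.ne rfl

/-- Sets that meet are nested, and a strictly smaller set has strictly more ancestors, so the deeper
layer must lie inside. -/
theorem subset_of_mem_layer (hT : IsSparseTree μ T) {Q P : Set X} {k l : ℕ} (hQ : Q ∈ layer T k)
    (hP : P ∈ layer T l) (hkl : k ≤ l) (h : ¬Disjoint P Q) : P ⊆ Q := by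
  rcases hT.nested P hP.1 Q hQ.1 with h' | h' | h'
  · exact absurd h' h
  · exact h'
  · by_contra hne
    have := hT.ncard_lt hQ.1 hP.1 ⟨h', hne⟩
    rw [hQ.2, hP.2] at this
    omega

theorem pairwiseDisjoint_layer (hT : IsSparseTree μ T) (k : ℕ) :
    (layer T k).PairwiseDisjoint id := by
  intro Q hQ P hP hne
  by_contra h
  exact hne (Subset.antisymm
    (hT.subset_of_mem_layer hP hQ le_rfl h)
    (hT.subset_of_mem_layer hQ hP le_rfl fun h' => h h'.symm))

/-- The ancestors of a set all contain it, hence form a finite chain; the minimal one has all the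
others as its own ancestors. -/
theorem exists_parent (hT : IsSparseTree μ T) {Q : Set X} {k : ℕ} (hQ : Q ∈ layer T (k + 1)) :
    ∃ P ∈ layer T k, Q ⊂ P := by
  have hfin := hT.finite_ancestors Q hQ.1
  have hne : {P | P ∈ T ∧ Q ⊂ P}.Nonempty := by
    rw [← ncard_pos hfin, hQ.2]
    omega
  obtain ⟨P, hP⟩ := hfin.exists_minimal hne
  refine ⟨P, ⟨hP.prop.1, ?_⟩, hP.prop.2⟩
  have heq : {R | R ∈ T ∧ Q ⊂ R} = insert P {R | R ∈ T ∧ P ⊂ R} := by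
    ext R
    constructor
    · rintro ⟨hR, hQR⟩
      by_cases hPR : P = R
      · exact Or.inl hPR.symm
      right
      refine ⟨hR, ?_⟩
      rcases hT.nested P hP.prop.1 R hR with h | h | h
      · obtain ⟨x, hx⟩ := hT.nonempty Q hQ.1
        exact absurd (hQR.1 hx) (Set.disjoint_left.1 h (hP.prop.2.1 hx))
      · exact h.ssubset_of_ne hPR
      · exact absurd (Subset.antisymm (hP.le_of_le ⟨hR, hQR⟩ h) h) hPR
    · rintro (rfl | hR)
      · exact hP.prop
      · exact ⟨hR.1, hP.prop.2.trans hR.2⟩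
  have h1 := hQ.2
  rw [heq, ncard_insert_of_notMem (fun h => h.2.ne rfl) (hT.finite_ancestors P hP.prop.1)] at h1
  omega

theorem exists_ancestor (hT : IsSparseTree μ T) {Q : Set X} {k j : ℕ}
    (hQ : Q ∈ layer T (k + j)) : ∃ P ∈ layer T k, Q ⊆ P := by
  induction j generalizing Q with
  | zero => exact ⟨Q, hQ, Subset.rfl⟩
  | succ j ih =>
    obtain ⟨P, hP, hQP⟩ := hT.exists_parent hQ
    obtain ⟨R, hR, hPR⟩ := ih hP
    exact ⟨R, hR, hQP.1.trans hPR⟩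

theorem measure_biUnion_layer (hT : IsSparseTree μ T) (ν : Measure X) {C : Set (Set X)} {k : ℕ}
    (hC : C ⊆ layer T k) : ν (⋃₀ C) = ∑' Q : C, ν Q := by
  rw [sUnion_eq_biUnion]
  exact measure_biUnion (hT.countable.mono (hC.trans (layer_subset T k)))
    ((hT.pairwiseDisjoint_layer k).subset hC) fun Q hQ => hT.measurable Q (hC hQ).1

/-- Each set of the next layer is a proper descendant of its parent, so sparseness, summed over the
disjoint parents, gains a factor 1/2 per layer. -/
theorem measure_descendants_le (hT : IsSparseTree μ T) {Q : Set X} {k : ℕ} (hQ : Q ∈ layer T k)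
    (j : ℕ) : μ (⋃₀ {P | P ∈ layer T (k + j) ∧ P ⊆ Q}) ≤ 2⁻¹ ^ j * μ Q := by
  induction j with
  | zero => simpa using measure_mono (sUnion_subset fun P hP => hP.2)
  | succ j ih =>
    set D := {P | P ∈ layer T (k + j) ∧ P ⊆ Q} with hD
    have hsub : ⋃₀ {P | P ∈ layer T (k + (j + 1)) ∧ P ⊆ Q} ⊆
        ⋃ P ∈ D, ⋃₀ {R | R ∈ T ∧ R ⊂ P} := by
      refine sUnion_subset fun R hR => ?_
      obtain ⟨P, hP, hRP⟩ := hT.exists_parent (k := k + j) hR.1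
      have hPQ : P ⊆ Q := by
        refine hT.subset_of_mem_layer hQ hP (by omega) ?_
        obtain ⟨x, hx⟩ := hT.nonempty R hR.1.1
        exact Set.not_disjoint_iff.2 ⟨x, hRP.1 hx, hR.2 hx⟩
      exact (subset_sUnion_of_mem (show R ∈ {R | R ∈ T ∧ R ⊂ P} from ⟨hR.1.1, hRP⟩)).trans
        (subset_biUnion_of_mem (u := fun P => ⋃₀ {R | R ∈ T ∧ R ⊂ P}) (show P ∈ D from ⟨hP, hPQ⟩))
    have hDl : D ⊆ layer T (k + j) := fun P hP => hP.1
    have hDc : D.Countable := hT.countable.mono (hDl.trans (layer_subset T _))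
    calc _ ≤ μ (⋃ P ∈ D, ⋃₀ {R | R ∈ T ∧ R ⊂ P}) := measure_mono hsub
      _ ≤ ∑' P : D, μ (⋃₀ {R | R ∈ T ∧ R ⊂ (P : Set X)}) := measure_biUnion_le μ hDc _
      _ ≤ ∑' P : D, 2⁻¹ * μ P := ENNReal.tsum_le_tsum fun P => hT.sparse P (hDl P.2).1
      _ = 2⁻¹ * μ (⋃₀ D) := by rw [ENNReal.tsum_mul_left, hT.measure_biUnion_layer μ hDl]
      _ ≤ 2⁻¹ * (2⁻¹ ^ j * μ Q) := by gcongr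
      _ = _ := by rw [pow_succ', mul_assoc]

theorem tsum_layer_le (hT : IsSparseTree μ T) (f : Set X → ℝ≥0∞) (k j : ℕ) :
    ∑' Q : layer T (k + j), f Q ≤
      ∑' P : layer T k, ∑' Q : {Q | Q ∈ layer T (k + j) ∧ Q ⊆ (P : Set X)}, f Q := by
  refine le_trans (ENNReal.tsum_mono_subtype f ?_) (ENNReal.tsum_iUnion_le_tsum f _)
  intro Q hQ
  obtain ⟨P, hP, hQP⟩ := hT.exists_ancestor hQ
  exact mem_iUnion.2 ⟨⟨P, hP⟩, hQ, hQP⟩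

/-- If `h Q` is comparable with `μ(Q) ^ β`, `β ≥ 1`, on a sparse tree, then the sums of `h` over
the layers decay geometrically. -/
theorem tsum_layer_le_of_comparable (hT : IsSparseTree μ T) {h : Set X → ℝ≥0∞} {x c : ℝ≥0∞} {β : ℝ}
    (hβ : 1 ≤ β) (h1 : ∀ Q ∈ T, x * μ Q ^ β ≤ h Q) (h2 : ∀ Q ∈ T, h Q ≤ c * (x * μ Q ^ β))
    (k : ℕ) : ∑' Q : layer T k, h Q ≤ c * 2⁻¹ ^ k * ∑' Q : layer T 0, h Q := by
  calc ∑' Q : layer T k, h Q = ∑' Q : layer T (0 + k), h Q := by rw [zero_add]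
    _ ≤ ∑' P : layer T 0, ∑' Q : {Q | Q ∈ layer T (0 + k) ∧ Q ⊆ (P : Set X)}, h Q :=
        hT.tsum_layer_le h 0 k
    _ ≤ ∑' P : layer T 0, c * 2⁻¹ ^ k * h P := by
        refine ENNReal.tsum_le_tsum fun P => ?_
        set D := {Q | Q ∈ layer T (0 + k) ∧ Q ⊆ (P : Set X)} with hD
        have hDl : D ⊆ layer T (0 + k) := fun Q hQ => hQ.1
        calc ∑' Q : D, h Q ≤ ∑' Q : D, c * (x * μ Q ^ β) :=
              ENNReal.tsum_le_tsum fun Q => h2 Q (hDl Q.2).1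
          _ = c * (x * ∑' Q : D, μ Q ^ β) := by rw [ENNReal.tsum_mul_left, ENNReal.tsum_mul_left]
          -- For β ≥ 1 the power is superadditive, which turns the sum over disjoint sets into the
          -- measure of their union.
          _ ≤ c * (x * (∑' Q : D, μ Q) ^ β) := by gcongr; exact tsum_rpow_le_rpow_tsum hβ _
          _ = c * (x * μ (⋃₀ D) ^ β) := by rw [hT.measure_biUnion_layer μ hDl]
          _ ≤ c * (x * (2⁻¹ ^ k * μ P) ^ β) := by gcongr; exact hT.measure_descendants_le P.2 k
          _ ≤ c * (x * (2⁻¹ ^ k * μ P ^ β)) := by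
              gcongr
              rw [ENNReal.mul_rpow_of_nonneg _ _ (by linarith)]
              gcongr
              exact ENNReal.rpow_le_self_of_le_one (pow_le_one₀ zero_le (by simp)) hβ
          _ = c * 2⁻¹ ^ k * (x * μ P ^ β) := by ring
          _ ≤ c * 2⁻¹ ^ k * h P := by gcongr; exact h1 P P.2.1
    _ = _ := ENNReal.tsum_mul_left

/-- A quantitative absolute continuity of `ν` with respect to `μ` on the sets of a sparse tree
implies that the tree is a Carleson family for `ν`. -/
theorem tsum_measure_le (hT : IsSparseTree μ T) (ν : Measure X) {R : Set X} (hR : ∀ Q ∈ T, Q ⊆ R)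
    {j : ℕ} (hj : j ≠ 0) (h : ∀ Q ∈ T, ∀ E ⊆ Q, MeasurableSet E → μ E ≤ 2⁻¹ ^ j * μ Q →
      ν E ≤ 3 / 4 * ν Q) :
    ∑' Q : T, ν Q ≤ 4 * j * ν R := by
  have hstep : ∀ k, ∑' Q : layer T (k + j), ν Q ≤ 3 / 4 * ∑' Q : layer T k, ν Q := fun k => by
    refine (hT.tsum_layer_le (fun Q => ν Q) k j).trans ?_
    rw [← ENNReal.tsum_mul_left]
    refine ENNReal.tsum_le_tsum fun P => ?_
    have hDl : {Q | Q ∈ layer T (k + j) ∧ Q ⊆ (P : Set X)} ⊆ layer T (k + j) := fun Q hQ => hQ.1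
    rw [← hT.measure_biUnion_layer ν hDl]
    refine h P P.2.1 _ (sUnion_subset fun Q hQ => hQ.2) ?_ (hT.measure_descendants_le P.2 j)
    exact MeasurableSet.sUnion (hT.countable.mono (hDl.trans (layer_subset T _)))
      fun Q hQ => hT.measurable Q (hDl hQ).1
  have hzero : ∀ k, ∑' Q : layer T k, ν Q ≤ ν R := fun k => by
    rw [← hT.measure_biUnion_layer ν Subset.rfl]
    exact measure_mono (sUnion_subset fun Q hQ => hR Q hQ.1)
  have hpow : ∀ i r, ∑' Q : layer T (r + j * i), ν Q ≤ (3 / 4) ^ i * ν R := fun i r => by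
    induction i with
    | zero => simpa using hzero r
    | succ i ih =>
      calc ∑' Q : layer T (r + j * (i + 1)), ν Q ≤ 3 / 4 * ∑' Q : layer T (r + j * i), ν Q := by
            rw [mul_add, mul_one, ← add_assoc]
            exact hstep _
        _ ≤ 3 / 4 * ((3 / 4) ^ i * ν R) := by gcongr
        _ = _ := by rw [pow_succ', mul_assoc]
  have hgeom : ∑' i : ℕ, (3 / 4 : ℝ≥0∞) ^ i = 4 := by
    rw [ENNReal.tsum_geometric]
    have : (1 - 3 / 4 : ℝ≥0∞) = 4⁻¹ := by
      refine ENNReal.sub_eq_of_eq_add (by finiteness) ?_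
      rw [← one_div, ENNReal.div_add_div_same, show (1 : ℝ≥0∞) + 3 = 4 by norm_num]
      exact (ENNReal.div_self (by norm_num) (by norm_num)).symm
    rw [this, inv_inv]
  have : NeZero j := ⟨hj⟩
  calc ∑' Q : T, ν Q ≤ ∑' k, ∑' Q : layer T k, ν Q := tsum_le_tsum_layer fun Q => ν Q
    -- Decay by 3/4 occurs only every j layers: each of the j residue classes mod j gives a
    -- geometric series of sum 4.
    _ ≤ ∑' k : ℕ, (3 / 4) ^ (k / j) * ν R := by
        refine ENNReal.tsum_le_tsum fun k => ?_
        conv_lhs => rw [← Nat.mod_add_div k j]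
        exact hpow _ _
    _ = ∑' z : ℕ × Fin j, (3 / 4) ^ z.1 * ν R := by
        rw [← (Nat.divModEquiv j).symm.tsum_eq]
        refine tsum_congr fun z => ?_
        congr 2
        change (Nat.divModEquiv j ((Nat.divModEquiv j).symm z)).1 = z.1
        rw [Equiv.apply_symm_apply]
    _ = _ := by
        rw [ENNReal.tsum_prod (f := fun (i : ℕ) (_ : Fin j) => (3 / 4 : ℝ≥0∞) ^ i * ν R)]
        simp only [tsum_fintype, Finset.sum_const, Finset.card_univ, Fintype.card_fin, nsmul_eq_mul]
        rw [ENNReal.tsum_mul_left, ENNReal.tsum_mul_right, hgeom]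
        ring

end IsSparseTree

/-! ### The embedding theorem for sparse trees. -/

theorem tsum_tsum_fiber_le {X ι : Type*} (T : Set X) (b : X → ι) (h : X → ℝ≥0∞) :
    ∑' i, ∑' Q : {Q | Q ∈ T ∧ b Q = i}, h Q ≤ ∑' Q : T, h Q := by
  rw [← ENNReal.tsum_sigma (fun i (Q : {Q | Q ∈ T ∧ b Q = i}) => h Q)]
  refine ENNReal.tsum_comp_le_tsum_of_injective
    (f := fun z : (Σ i, {Q | Q ∈ T ∧ b Q = i}) => (⟨z.2.1, z.2.2.1⟩ : T)) ?_ (fun Q => h Q)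
  rintro ⟨i, Q, hQ, rfl⟩ ⟨j, P, hP, rfl⟩ h
  obtain rfl : Q = P := congrArg Subtype.val h
  rfl

/-- An embedding theorem for a sparse tree. The tree is split according to the value of `m`; on
each part, `a(Q) ^ q * ν(Q)` is comparable with `a(Q) ^ r * μ(Q) ^ β` for some `β ≥ 1`. -/
theorem IsSparseTree.lintegral_tsum_rpow_le {X : Type*} [MeasurableSpace X] {μ : Measure X}
    {T : Set (Set X)} (hT : IsSparseTree μ T) (ν : Measure X) {a : Set X → ℝ≥0∞} {m : Set X → ℕ}
    {y : ℕ → ℝ≥0∞} {c : ℝ≥0∞} {q r β : ℝ} (hq : 1 ≤ q) (hr : 0 ≤ r) (hβ : 1 ≤ β)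
    (ha0 : ∀ Q ∈ T, a Q ≠ 0) (ha : ∀ Q ∈ T, a Q ≠ ∞)
    (h1 : ∀ Q ∈ T, y (m Q) * (a Q ^ r * μ Q ^ β) ≤ a Q ^ q * ν Q)
    (h2 : ∀ Q ∈ T, a Q ^ q * ν Q ≤ c * (y (m Q) * (a Q ^ r * μ Q ^ β))) :
    (∫⁻ x, (∑' Q : T, (Q : Set X).indicator (fun _ => a Q) x) ^ q ∂ν) ^ (1 / q) ≤
      4 * (c * 2 ^ r) ^ (1 / q) * (∑' k : ℕ, ((2⁻¹ : ℝ≥0∞) ^ (1 / q)) ^ k) *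
        ∑' i, (∑' Q : {Q | Q ∈ T ∧ m Q = i}, a Q ^ q * ν Q) ^ (1 / q) := by
  have hq0 : 0 < q := by linarith
  have hq0' : 0 ≤ 1 / q := by positivity
  have hb : ∀ Q, ∃ b : ℤ, Q ∈ T → 2 ^ b ≤ a Q ∧ a Q ≤ 2 * 2 ^ b := fun Q => by
    by_cases hQ : Q ∈ T
    · obtain ⟨b, hb1, hb2⟩ := ENNReal.exists_mem_Ico_zpow (ha0 Q hQ) (ha Q hQ) (y := 2)
        (by norm_num) (by norm_num)
      refine ⟨b, fun _ => ⟨hb1, hb2.le.trans ?_⟩⟩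
      rw [ENNReal.zpow_add (by norm_num) (by norm_num), zpow_one, mul_comm]
    · exact ⟨0, fun h => absurd h hQ⟩
  choose b hb using hb
  set h : Set X → ℝ≥0∞ := fun Q => a Q ^ q * ν Q with hh
  set C : ℕ → ℤ → Set (Set X) := fun i j => {Q | Q ∈ {Q | Q ∈ T ∧ m Q = i} ∧ b Q = j} with hC
  have hCT : ∀ i j, C i j ⊆ T := fun i j Q hQ => hQ.1.1
  have htree : ∀ i j, IsSparseTree μ (C i j) := fun i j => hT.mono (hCT i j)
  -- Layers are taken inside each class `C i j` separately, then the layers of equal depth are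
  -- united over all dyadic sizes j of `a`.
  set U : ℕ × ℕ → Set (Set X) := fun z => ⋃ j, layer (C z.1 j) z.2 with hU
  have hUT : ∀ z, U z ⊆ T := fun z => iUnion_subset fun j => (layer_subset _ _).trans (hCT _ j)
  have hcount : ∀ z, Countable (U z) := fun z => (hT.countable.mono (hUT z)).to_subtype
  have hind : ∀ Q ∈ T, Measurable (Q.indicator fun _ => a Q) := fun Q hQ =>
    measurable_const.indicator (hT.measurable Q hQ)
  have hcover : T ⊆ ⋃ z, U z := fun Q hQ =>
    mem_iUnion.2 ⟨(m Q, {P | P ∈ C (m Q) (b Q) ∧ Q ⊂ P}.ncard), mem_iUnion.2 ⟨b Q, ⟨⟨hQ, rfl⟩, rfl⟩, rfl⟩⟩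
  have hdecay : ∀ z, ∑' Q : U z, h Q ≤
      c * 2 ^ r * 2⁻¹ ^ z.2 * ∑' Q : {Q | Q ∈ T ∧ m Q = z.1}, h Q := by
    rintro ⟨i, k⟩
    calc ∑' Q : U (i, k), h Q ≤ ∑' j, ∑' Q : layer (C i j) k, h Q :=
          ENNReal.tsum_iUnion_le_tsum h _
      _ ≤ ∑' j, c * 2 ^ r * 2⁻¹ ^ k * ∑' Q : C i j, h Q := by
          refine ENNReal.tsum_le_tsum fun j => ?_
          refine ((htree i j).tsum_layer_le_of_comparable (x := y i * (2 ^ j) ^ r) (c := c * 2 ^ r)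
            hβ ?_ ?_ k).trans ?_
          · rintro Q ⟨⟨hQ, rfl⟩, rfl⟩
            refine le_trans ?_ (h1 Q hQ)
            rw [mul_assoc]
            gcongr
            exact (hb Q hQ).1
          · rintro Q ⟨⟨hQ, rfl⟩, rfl⟩
            refine (h2 Q hQ).trans ?_
            calc c * (y (m Q) * (a Q ^ r * μ Q ^ β))
                ≤ c * (y (m Q) * ((2 * 2 ^ b Q) ^ r * μ Q ^ β)) := by
                  gcongr
                  exact (hb Q hQ).2
              _ = _ := by
                  rw [ENNReal.mul_rpow_of_nonneg _ _ hr]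
                  ring
          · gcongr
            exact ENNReal.tsum_mono_subtype h (layer_subset _ _)
      _ = c * 2 ^ r * 2⁻¹ ^ k * ∑' j, ∑' Q : C i j, h Q := ENNReal.tsum_mul_left
      _ ≤ _ := by
          gcongr
          exact tsum_tsum_fiber_le _ b h
  have hpart : ∀ z, (∫⁻ x, (∑' Q : U z, (Q : Set X).indicator (fun _ => a Q) x) ^ q ∂ν) ≤
      4 ^ q * ∑' Q : U z, h Q := fun z => by
    calc _ ≤ ∫⁻ x, 4 ^ q * ∑' Q : U z, ((Q : Set X).indicator (fun _ => a Q) x) ^ q ∂ν := by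
          refine lintegral_mono fun x => ?_
          have hsupp : ∀ Q : U z, Q ∈ Function.support (fun Q : U z =>
              (Q : Set X).indicator (fun _ => a Q) x) → x ∈ (Q : Set X) := fun Q hQ => by
            by_contra hx
            exact hQ (indicator_of_notMem hx _)
          -- Two cubes of `U z` through x with the same exponent lie in one layer of one class,
          -- whose members are disjoint, so they coincide.
          refine rpow_tsum_le_of_lacunary hq0 _ (fun Q => b Q) ?_ ?_ ?_
          · intro Q hQ P hP hQP
            obtain ⟨j, hj⟩ := mem_iUnion.1 Q.2
            obtain ⟨j', hj'⟩ := mem_iUnion.1 P.2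
            have e1 : b Q = j := hj.1.2
            have e2 : b P = j' := hj'.1.2
            obtain rfl : j = j' := e1 ▸ e2 ▸ hQP
            refine Subtype.ext (((htree _ _).pairwiseDisjoint_layer _).elim hj hj' ?_)
            exact Set.not_disjoint_iff.2 ⟨x, hsupp Q hQ, hsupp P hP⟩
          · intro Q hQ
            simp only [indicator_of_mem (hsupp Q hQ)]
            exact (hb Q (hUT z Q.2)).1
          · intro Q hQ
            simp only [indicator_of_mem (hsupp Q hQ)]
            exact (hb Q (hUT z Q.2)).2
      _ = 4 ^ q * ∑' Q : U z, ∫⁻ x, ((Q : Set X).indicator (fun _ => a Q) x) ^ q ∂ν := by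
          have := hcount z
          rw [lintegral_const_mul' _ _ (by finiteness), lintegral_tsum]
          exact fun Q => ((hind Q (hUT z Q.2)).pow_const q).aemeasurable
      _ = 4 ^ q * ∑' Q : U z, h Q := by
          congr 1
          refine tsum_congr fun Q => ?_
          have : ∀ x, ((Q : Set X).indicator (fun _ => a Q) x) ^ q =
              (Q : Set X).indicator (fun _ => a Q ^ q) x := fun x => by
            by_cases hx : x ∈ (Q : Set X) <;> simp [hx, hq0]
          simp_rw [this]
          rw [lintegral_indicator (hT.measurable Q (hUT z Q.2)), setLIntegral_const]
  calc _ ≤ (∫⁻ x, (∑' z, ∑' Q : U z, (Q : Set X).indicator (fun _ => a Q) x) ^ q ∂ν) ^ (1 / q) := by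
        gcongr with x
        exact (ENNReal.tsum_mono_subtype (fun Q : Set X => Q.indicator (fun _ => a Q) x)
          hcover).trans (ENNReal.tsum_iUnion_le_tsum (fun Q : Set X => Q.indicator (fun _ => a Q) x) U)
    _ ≤ ∑' z, (∫⁻ x, (∑' Q : U z, (Q : Set X).indicator (fun _ => a Q) x) ^ q ∂ν) ^ (1 / q) := by
        refine lintegral_Lp_tsum_le hq fun z => ?_
        have := hcount z
        exact (Measurable.tsum fun Q : U z => hind Q (hUT z Q.2)).aemeasurable
    _ ≤ ∑' z : ℕ × ℕ, 4 * (c * 2 ^ r) ^ (1 / q) * ((2⁻¹ : ℝ≥0∞) ^ (1 / q)) ^ z.2 *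
          (∑' Q : {Q | Q ∈ T ∧ m Q = z.1}, h Q) ^ (1 / q) := by
        refine ENNReal.tsum_le_tsum fun z => ?_
        calc _ ≤ (4 ^ q * (c * 2 ^ r * 2⁻¹ ^ z.2 *
              ∑' Q : {Q | Q ∈ T ∧ m Q = z.1}, h Q)) ^ (1 / q) := by
              gcongr
              exact (hpart z).trans (by gcongr; exact hdecay z)
          _ = _ := by
              rw [ENNReal.mul_rpow_of_nonneg _ _ hq0', ENNReal.mul_rpow_of_nonneg _ _ hq0',
                ENNReal.mul_rpow_of_nonneg _ _ hq0', ← ENNReal.rpow_mul, mul_one_div_cancel hq0.ne',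
                ENNReal.rpow_one, ← ENNReal.rpow_natCast, ← ENNReal.rpow_natCast,
                ← ENNReal.rpow_mul, ← ENNReal.rpow_mul, mul_comm (1 / q)]
              ring
    _ = 4 * (c * 2 ^ r) ^ (1 / q) * (∑' k : ℕ, ((2⁻¹ : ℝ≥0∞) ^ (1 / q)) ^ k) *
          ∑' i, (∑' Q : {Q | Q ∈ T ∧ m Q = i}, h Q) ^ (1 / q) := by
        rw [ENNReal.tsum_prod (f := fun i k : ℕ => 4 * (c * 2 ^ r) ^ (1 / q) *
          ((2⁻¹ : ℝ≥0∞) ^ (1 / q)) ^ k * (∑' Q : {Q | Q ∈ T ∧ m Q = i}, h Q) ^ (1 / q))]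
        simp_rw [ENNReal.tsum_mul_right, ENNReal.tsum_mul_left]

/-! ### Logarithmic bumps and quantitative absolute continuity. -/

/-- Supplies the truncation height e^N and the number j of layers for level m. With B = 2^{(m+1)r},
the last two bounds make the parts above and below the truncation at most 1/2 and 1/4 of the mass; j
grows only like N, that is, like B^{1/γ}. -/
theorem exists_generation_count {r γ : ℝ} (hr : 0 < r) (hγ : 0 < γ) :
    ∃ c : ℝ≥0, ∀ m : ℕ, ∃ (j : ℕ) (N : ℝ), j ≠ 0 ∧ (j : ℝ≥0∞) ≤ c * 2 ^ (m * (r / γ)) ∧ 0 < N ∧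
      2 * 2 ^ ((m + 1) * r) ≤ N ^ γ ∧ Real.exp (N * r) * 2 ^ ((m + 1) * r) * 4 ≤ 2 ^ j := by
  refine ⟨Real.toNNReal ((2 * (r + γ) + 2) * 2 ^ ((1 + r) / γ)), fun m => ?_⟩
  set N : ℝ := 2 ^ ((1 + (m + 1) * r) / γ) with hN
  have hN0 : 0 < N := by positivity
  have hN1 : 1 ≤ N := Real.one_le_rpow (by norm_num) (by positivity)
  have hNγ : N ^ γ = 2 * 2 ^ ((m + 1) * r) := by
    rw [hN, ← Real.rpow_mul (by norm_num), div_mul_cancel₀ _ hγ.ne', Real.rpow_add (by norm_num),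
      Real.rpow_one]
  -- The factor 2 in the ceiling is for log 2 > 1/2, so that the power of two dominates e^{N(r+γ)};
  -- the extra 1 absorbs the factor left from 4B = 2N^γ.
  refine ⟨⌈2 * N * (r + γ)⌉₊ + 1, N, by omega, ?_, hN0, hNγ.ge, ?_⟩
  · have hle : ((⌈2 * N * (r + γ)⌉₊ + 1 : ℕ) : ℝ) ≤
        (2 * (r + γ) + 2) * 2 ^ ((1 + r) / γ) * 2 ^ (m * (r / γ)) := by
      have h1 := (Nat.ceil_lt_add_one (show 0 ≤ 2 * N * (r + γ) by positivity)).le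
      have h2 : (2 : ℝ) ^ ((1 + r) / γ) * 2 ^ (m * (r / γ)) = N := by
        rw [← Real.rpow_add (by norm_num), hN]
        congr 1
        field_simp
        ring
      rw [mul_assoc _ ((2 : ℝ) ^ ((1 + r) / γ)), h2]
      push_cast
      nlinarith
    have h3 := ENNReal.ofReal_le_ofReal hle
    rw [ENNReal.ofReal_natCast, ENNReal.ofReal_mul (by positivity),
      ← ENNReal.ofReal_rpow_of_pos (by norm_num : (0 : ℝ) < 2)] at h3
    rwa [ENNReal.ofReal_ofNat] at h3
  · have h1 : N ^ γ ≤ Real.exp (N * γ) := by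
      rw [Real.rpow_def_of_pos hN0]
      gcongr
      exact (Real.log_le_sub_one_of_pos hN0).trans (by linarith)
    have h2 : Real.exp (N * (r + γ)) ≤ 2 ^ ⌈2 * N * (r + γ)⌉₊ := by
      rw [← Real.rpow_natCast, Real.rpow_def_of_pos (by norm_num), Real.exp_le_exp]
      have := Nat.le_ceil (2 * N * (r + γ))
      have := Real.log_two_gt_d9
      have : 0 < N * (r + γ) := by positivity
      nlinarith
    calc Real.exp (N * r) * 2 ^ ((m + 1) * r) * 4 = Real.exp (N * r) * N ^ γ * 2 := by
          rw [hNγ]; ring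
      _ ≤ Real.exp (N * r) * Real.exp (N * γ) * 2 := by gcongr
      _ = Real.exp (N * (r + γ)) * 2 := by rw [← Real.exp_add]; congr 2; ring
      _ ≤ _ := by rw [pow_succ]; gcongr

theorem rpow_le_logBump {r γ t : ℝ} (hγ : 0 ≤ γ) (ht : 0 ≤ t) : t ^ r ≤ logBump r γ t := by
  refine le_mul_of_one_le_right (by positivity) (Real.one_le_rpow ?_ hγ)
  rw [Real.le_log_iff_exp_le (by positivity)]
  linarith

/-- Truncation at t = e^N: above it the logarithm is at least N, so the bump exceeds t^r by a factor
N^γ. -/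
theorem rpow_le_add_logBump {r γ t N : ℝ} (hr : 0 < r) (hγ : 0 < γ) (hN : 0 < N) (ht : 0 ≤ t) :
    t ^ r ≤ Real.exp (N * r) + (N ^ γ)⁻¹ * logBump r γ t := by
  rcases le_total t (Real.exp N) with h | h
  · have h1 : t ^ r ≤ Real.exp (N * r) := by
      rw [Real.exp_mul]
      gcongr
    have h2 : 0 ≤ logBump r γ t := (by positivity : 0 ≤ t ^ r).trans (rpow_le_logBump hγ.le ht)
    have : 0 ≤ (N ^ γ)⁻¹ * logBump r γ t := by positivity
    linarith
  · have h1 : N ≤ Real.log (Real.exp 1 + t) := by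
      rw [Real.le_log_iff_exp_le (by positivity)]
      linarith [Real.exp_pos 1]
    have h2 : t ^ r ≤ (N ^ γ)⁻¹ * logBump r γ t := by
      rw [inv_mul_eq_div, le_div_iff₀ (by positivity)]
      unfold logBump
      gcongr
    linarith [Real.exp_pos (N * r)]

section Cubes

variable {n : ℕ}

theorem cubeAvg_le_one {Q : Set (Fin n → ℝ)} (hQ0 : volume Q ≠ 0) (hQ : volume Q ≠ ∞)
    {f : (Fin n → ℝ) → ℝ≥0∞} (h : cubeAvg f Q ≤ 1) : ∫⁻ x in Q, f x ≤ volume Q := by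
  unfold cubeAvg at h
  rwa [← ENNReal.div_eq_inv_mul, ENNReal.div_le_iff hQ0 hQ, one_mul] at h

/-- An admissible value in the Luxemburg norm dominates the averaged `L ^ r` norm. -/
theorem lintegral_le_of_logBump {w : (Fin n → ℝ) → ℝ} (hw : ∀ x, 0 ≤ w x) {r γ l : ℝ} (hr : 0 < r)
    (hγ : 0 ≤ γ) (hl : 0 < l) {Q : Set (Fin n → ℝ)}
    (h : ∫⁻ x in Q, ENNReal.ofReal (logBump r γ (|w x ^ (1 / r)| / l)) ≤ volume Q) :
    ∫⁻ x in Q, ENNReal.ofReal (w x) ≤ ENNReal.ofReal l ^ r * volume Q := by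
  calc ∫⁻ x in Q, ENNReal.ofReal (w x)
      ≤ ∫⁻ x in Q, ENNReal.ofReal l ^ r * ENNReal.ofReal (logBump r γ (|w x ^ (1 / r)| / l)) := by
        refine lintegral_mono fun x => ?_
        have hwx := hw x
        rw [ENNReal.ofReal_rpow_of_pos hl, ← ENNReal.ofReal_mul (by positivity)]
        refine ENNReal.ofReal_le_ofReal ?_
        calc w x = l ^ r * (|w x ^ (1 / r)| / l) ^ r := by
              rw [abs_of_nonneg (by positivity), Real.div_rpow (by positivity) hl.le,
                ← Real.rpow_mul hwx, one_div_mul_cancel hr.ne', Real.rpow_one]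
              field_simp
          _ ≤ _ := by
              gcongr
              exact rpow_le_logBump hγ (by positivity)
    _ = ENNReal.ofReal l ^ r *
          ∫⁻ x in Q, ENNReal.ofReal (logBump r γ (|w x ^ (1 / r)| / l)) := by
        rw [lintegral_const_mul' _ _ (by finiteness)]
    _ ≤ _ := by gcongr

/-- A logarithmic bump bound makes the measure `w dx` quantitatively absolutely continuous. -/
theorem lintegral_le_three_quarters_of_logBump {w : (Fin n → ℝ) → ℝ} (hw : ∀ x, 0 ≤ w x)
    {r γ l N B : ℝ} {j : ℕ} (hr : 0 < r) (hγ : 0 < γ) (hl : 0 < l) (hN : 0 < N) (hB : 0 < B)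
    (hNB : 2 * B ≤ N ^ γ) (hj : Real.exp (N * r) * B * 4 ≤ 2 ^ j) {Q E : Set (Fin n → ℝ)}
    (hEQ : E ⊆ Q) (hE : volume E ≤ 2⁻¹ ^ j * volume Q)
    (h : ∫⁻ x in Q, ENNReal.ofReal (logBump r γ (|w x ^ (1 / r)| / l)) ≤ volume Q)
    (hlB : ENNReal.ofReal l ^ r * volume Q ≤ ENNReal.ofReal B * ∫⁻ x in Q, ENNReal.ofReal (w x)) :
    ∫⁻ x in E, ENNReal.ofReal (w x) ≤ 3 / 4 * ∫⁻ x in Q, ENNReal.ofReal (w x) := by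
  have hlr : 0 < l ^ r := by positivity
  have hpt : ∀ x, ENNReal.ofReal (w x) ≤ ENNReal.ofReal (l ^ r * Real.exp (N * r)) +
      ENNReal.ofReal (l ^ r * (N ^ γ)⁻¹) *
        ENNReal.ofReal (logBump r γ (|w x ^ (1 / r)| / l)) := fun x => by
    have hwx := hw x
    rw [← ENNReal.ofReal_mul (by positivity), ← ENNReal.ofReal_add (by positivity)]
    · refine ENNReal.ofReal_le_ofReal ?_
      calc w x = l ^ r * (|w x ^ (1 / r)| / l) ^ r := by
            rw [abs_of_nonneg (by positivity), Real.div_rpow (by positivity) hl.le,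
              ← Real.rpow_mul hwx, one_div_mul_cancel hr.ne', Real.rpow_one]
            field_simp
        _ ≤ l ^ r * (Real.exp (N * r) +
              (N ^ γ)⁻¹ * logBump r γ (|w x ^ (1 / r)| / l)) := by
            gcongr
            exact rpow_le_add_logBump hr hγ hN (by positivity)
        _ = _ := by ring
    · have : 0 ≤ logBump r γ (|w x ^ (1 / r)| / l) :=
        (by positivity : 0 ≤ (|w x ^ (1 / r)| / l) ^ r).trans (rpow_le_logBump hγ.le (by positivity))
      positivity
  have hc1 : ENNReal.ofReal (Real.exp (N * r)) * 2⁻¹ ^ j ≤ ENNReal.ofReal ((4 * B)⁻¹) := by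
    have : (2⁻¹ : ℝ≥0∞) ^ j = ENNReal.ofReal ((2 ^ j)⁻¹) := by
      rw [ENNReal.ofReal_inv_of_pos (by positivity), ENNReal.ofReal_pow (by norm_num),
        ENNReal.inv_pow]
      norm_num
    rw [this, ← ENNReal.ofReal_mul (by positivity)]
    refine ENNReal.ofReal_le_ofReal ?_
    rw [← div_eq_mul_inv, div_le_iff₀ (by positivity), inv_mul_eq_div, le_div_iff₀ (by positivity)]
    linarith
  have hc2 : ENNReal.ofReal ((N ^ γ)⁻¹) ≤ ENNReal.ofReal ((2 * B)⁻¹) :=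
    ENNReal.ofReal_le_ofReal (by gcongr)
  calc ∫⁻ x in E, ENNReal.ofReal (w x)
      ≤ ∫⁻ x in E, (ENNReal.ofReal (l ^ r * Real.exp (N * r)) +
        ENNReal.ofReal (l ^ r * (N ^ γ)⁻¹) *
          ENNReal.ofReal (logBump r γ (|w x ^ (1 / r)| / l))) := lintegral_mono hpt
    _ = ENNReal.ofReal (l ^ r * Real.exp (N * r)) * volume E +
        ENNReal.ofReal (l ^ r * (N ^ γ)⁻¹) *
          ∫⁻ x in E, ENNReal.ofReal (logBump r γ (|w x ^ (1 / r)| / l)) := by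
        rw [lintegral_add_left measurable_const, setLIntegral_const,
          lintegral_const_mul' _ _ (by finiteness)]
    _ ≤ ENNReal.ofReal (l ^ r * Real.exp (N * r)) * (2⁻¹ ^ j * volume Q) +
        ENNReal.ofReal (l ^ r * (N ^ γ)⁻¹) * volume Q := by
        gcongr
        exact (lintegral_mono_set hEQ).trans h
    _ = (ENNReal.ofReal (Real.exp (N * r)) * 2⁻¹ ^ j + ENNReal.ofReal ((N ^ γ)⁻¹)) *
        (ENNReal.ofReal l ^ r * volume Q) := by
        rw [ENNReal.ofReal_mul hlr.le, ENNReal.ofReal_mul hlr.le, ENNReal.ofReal_rpow_of_pos hl]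
        ring
    -- The smallness of E pays for the truncated part, the gain N^γ ≥ 2B for the rest; multiplied by
    -- B they total 1/4 + 1/2.
    _ ≤ (ENNReal.ofReal ((4 * B)⁻¹) + ENNReal.ofReal ((2 * B)⁻¹)) *
        (ENNReal.ofReal B * ∫⁻ x in Q, ENNReal.ofReal (w x)) := by gcongr
    _ = _ := by
        rw [← mul_assoc, ← ENNReal.ofReal_add (by positivity) (by positivity),
          ← ENNReal.ofReal_mul (by positivity)]
        congr 1
        rw [show ((4 * B)⁻¹ + (2 * B)⁻¹) * B = 3 / 4 by field_simp; norm_num,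
          ENNReal.ofReal_div_of_pos (by norm_num)]
        norm_num

/-! ### Dyadic cubes as a sparse tree. -/

theorem volume_cube (a : Fin n → ℝ) (l : ℝ) : volume (cube a l) = ENNReal.ofReal l ^ n := by
  have : cube a l = Set.pi univ fun i => Ico (a i) (a i + l) := by
    ext x
    simp [cube]
  rw [this, volume_pi_pi]
  simp

theorem measurableSet_cube (a : Fin n → ℝ) (l : ℝ) : MeasurableSet (cube a l) := by
  have : cube a l = Set.pi univ fun i => Ico (a i) (a i + l) := by
    ext x
    simp [cube]
  rw [this]
  exact MeasurableSet.univ_pi fun i => measurableSet_Ico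

theorem IsWeight.lintegral_cube_ne_top {w : (Fin n → ℝ) → ℝ} (hw : IsWeight w) (a : Fin n → ℝ)
    (l : ℝ) : ∫⁻ x in cube a l, ENNReal.ofReal (w x) ≠ ∞ := by
  have hsub : cube a l ⊆ Icc a fun i => a i + l := fun x hx =>
    ⟨fun i => (hx i).1, fun i => (hx i).2.le⟩
  exact ((hw.2.integrableOn_isCompact isCompact_Icc).mono_set hsub).lintegral_lt_top.ne

theorem cube_subset_side_le (hn : n ≠ 0) {a b : Fin n → ℝ} {k l : ℤ}
    (h : cube a ((2 : ℝ) ^ k) ⊆ cube b ((2 : ℝ) ^ l)) : k ≤ l := by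
  have h1 := measure_mono (μ := volume) h
  rw [volume_cube, volume_cube, ENNReal.pow_le_pow_left_iff hn,
    ENNReal.ofReal_le_ofReal_iff (by positivity)] at h1
  exact (zpow_le_zpow_iff_right₀ (by norm_num)).1 h1

/-- The cubes of a sparse family contained in a fixed cube form a sparse tree. -/
theorem IsSparseSubset.isSparseTree (hn : n ≠ 0) {D S : Set (Set (Fin n → ℝ))}
    (hD : IsDyadicGrid D) (hS : IsSparseSubset D S) {R : Set (Fin n → ℝ)} (hR : R ∈ D) :
    IsSparseTree volume {Q | Q ∈ S ∧ Q ⊆ R} where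
  countable := hD.countable.mono fun Q hQ => hS.1 hQ.1
  measurable Q hQ := by
    obtain ⟨k, a, rfl⟩ := hD.side Q (hS.1 hQ.1)
    exact measurableSet_cube _ _
  nonempty Q hQ := by
    obtain ⟨k, a, rfl⟩ := hD.side Q (hS.1 hQ.1)
    exact ⟨a, fun i => ⟨le_rfl, by have : (0 : ℝ) < 2 ^ k := by positivity
                                   linarith⟩⟩
  nested Q hQ P hP := by
    rcases hD.nested Q (hS.1 hQ.1) P (hS.1 hP.1) with h | h | h
    · exact Or.inl (Set.disjoint_iff_inter_eq_empty.2 h)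
    · exact Or.inr (Or.inr (inter_eq_right.1 h))
    · exact Or.inr (Or.inl (inter_eq_left.1 h))
  -- Ancestors have side lengths between those of Q and R, and the partition property allows only
  -- one of each side length.
  finite_ancestors Q hQ := by
    obtain ⟨kR, aR, hkR⟩ := hD.side R hR
    obtain ⟨kQ, aQ, hkQ⟩ := hD.side Q (hS.1 hQ.1)
    have hside : ∀ P, ∃ k : ℤ, P ∈ D → ∃ a, P = cube a ((2 : ℝ) ^ k) := fun P => by
      by_cases hP : P ∈ D
      · obtain ⟨k, a, h⟩ := hD.side P hP
        exact ⟨k, fun _ => ⟨a, h⟩⟩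
      · exact ⟨0, fun h => absurd h hP⟩
    choose k hk using hside
    refine Set.Finite.of_finite_image (f := k) ((Set.finite_Icc kQ kR).subset ?_) ?_
    · rintro _ ⟨P, ⟨hP, hQP⟩, rfl⟩
      obtain ⟨a, ha⟩ := hk P (hS.1 hP.1)
      exact ⟨cube_subset_side_le hn (hkQ ▸ ha ▸ hQP.1), cube_subset_side_le hn (ha ▸ hkR ▸ hP.2)⟩
    · intro P hP P' hP' hkk
      have hx : aQ ∈ Q := by
        rw [hkQ]
        exact fun i => ⟨le_rfl, by have : (0 : ℝ) < 2 ^ kQ := by positivity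
                                   linarith⟩
      have h1 : P ∈ {Q | Q ∈ D ∧ ∃ a : Fin n → ℝ, Q = cube a ((2 : ℝ) ^ k P)} :=
        ⟨hS.1 hP.1.1, hk P (hS.1 hP.1.1)⟩
      have h2 : P' ∈ {Q | Q ∈ D ∧ ∃ a : Fin n → ℝ, Q = cube a ((2 : ℝ) ^ k P)} :=
        ⟨hS.1 hP'.1.1, hkk ▸ hk P' (hS.1 hP'.1.1)⟩
      exact (hD.partition (k P)).pairwiseDisjoint.elim h1 h2
        (Set.not_disjoint_iff.2 ⟨aQ, hP.2.1 hx, hP'.2.1 hx⟩)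
  sparse Q hQ := by
    refine (measure_mono (sUnion_subset_sUnion ?_)).trans (hS.2 Q hQ.1)
    exact fun _ h => ⟨h.1.1, h.2⟩

/-! ### The contribution of a single cube and the bump condition on it. -/

/-- With V = |Q|, U = u(Q), W = σ(Q), s = α/n this is a_Q^q u(Q) = A_Q^q σ(Q)^{q/p}, from 1 = 1/p +
1/p' in the exponent of W. -/
theorem riesz_rpow_mul_eq {s p q p' : ℝ} (hq : 0 < q) (hp' : p.HolderConjugate p') {V U W : ℝ≥0∞}
    (hV0 : V ≠ 0) (hV : V ≠ ∞) (hW0 : W ≠ 0) (hW : W ≠ ∞) :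
    (V ^ s * (V⁻¹ * W)) ^ q * U =
      (V ^ (s - 1) * U ^ (1 / q) * W ^ (1 / p')) ^ q * W ^ (q / p) := by
  have h1 : V ^ s * (V⁻¹ * W) = V ^ (s - 1) * W := by
    rw [← mul_assoc, ← ENNReal.rpow_neg_one, ← ENNReal.rpow_add _ _ hV0 hV, sub_eq_add_neg]
  have h2 : W ^ q = (W ^ (1 / p')) ^ q * W ^ (q / p) := by
    rw [← ENNReal.rpow_mul, ← ENNReal.rpow_add _ _ hW0 hW]
    congr 1
    have := hp'.inv_add_inv_eq_one
    calc q = q * (p⁻¹ + p'⁻¹) := by rw [this, mul_one]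
      _ = _ := by ring
  rw [h1, ENNReal.mul_rpow_of_nonneg _ _ hq.le, ENNReal.mul_rpow_of_nonneg _ _ hq.le,
    ENNReal.mul_rpow_of_nonneg _ _ hq.le, h2, ← ENNReal.rpow_mul U, one_div_mul_cancel hq.ne',
    ENNReal.rpow_one]
  ring

/-- Used with r = q/p, where the exponent of V = |Q| is the β of the embedding theorem. -/
theorem rpow_eq_riesz_rpow_mul {s r : ℝ} (hr : 0 ≤ r) {V W : ℝ≥0∞} (hV0 : V ≠ 0) (hV : V ≠ ∞) :
    W ^ r = (V ^ s * (V⁻¹ * W)) ^ r * V ^ ((1 - s) * r) := by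
  have h1 : V ^ s * (V⁻¹ * W) = V ^ (s - 1) * W := by
    rw [← mul_assoc, ← ENNReal.rpow_neg_one, ← ENNReal.rpow_add _ _ hV0 hV, sub_eq_add_neg]
  rw [h1, ENNReal.mul_rpow_of_nonneg _ _ hr, ← ENNReal.rpow_mul, mul_right_comm,
    ← ENNReal.rpow_add _ _ hV0 hV, show (s - 1) * r + (1 - s) * r = 0 by ring, ENNReal.rpow_zero,
    one_mul]

theorem exists_inv_two_pow_near {A κ : ℝ≥0∞} (hA : A ≠ 0) (hκ : κ ≠ ∞) (h : A ≤ κ) :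
    ∃ m : ℕ, κ * 2⁻¹ ^ (m + 1) ≤ A ∧ A ≤ κ * 2⁻¹ ^ m := by
  classical
  have hκ0 : κ ≠ 0 := fun h0 => hA (le_antisymm (h0 ▸ h) zero_le)
  have hex : ∃ m : ℕ, κ * 2⁻¹ ^ m < A := by
    obtain ⟨m, hm⟩ := ENNReal.exists_inv_two_pow_lt (a := A / κ) (ENNReal.div_ne_zero.2 ⟨hA, hκ⟩)
    refine ⟨m, ?_⟩
    rw [mul_comm]
    exact (ENNReal.lt_div_iff_mul_lt (Or.inl hκ0) (Or.inl hκ)).1 hm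
  have hne : Nat.find hex ≠ 0 := fun h0 => by
    have := Nat.find_spec hex
    rw [h0, pow_zero, mul_one] at this
    exact absurd h this.not_ge
  obtain ⟨m, hm⟩ := Nat.exists_eq_succ_of_ne_zero hne
  refine ⟨m, ?_, ?_⟩
  · have := Nat.find_spec hex
    rw [hm] at this
    exact this.le
  · exact not_lt.1 (Nat.find_min hex (m := m) (by omega))

/-- The consequences of the bump condition for a single cube. -/
theorem exists_admissible_of_bumpRight_le {α p q p' δ : ℝ} (hq : 0 < q)
    (hp' : p.HolderConjugate p') (hδ : 0 < δ) {u σ : (Fin n → ℝ) → ℝ} (hu : IsWeight u)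
    (hσ : IsWeight σ) {κ : ℝ≥0∞} (hκ0 : κ ≠ 0) (hκ : κ ≠ ∞) (hK : bumpRight α p q p' δ u σ ≤ κ)
    {Q : Set (Fin n → ℝ)} (hQ : IsCube Q) (hV0 : volume Q ≠ 0) (hV : volume Q ≠ ∞)
    (hU0 : ∫⁻ x in Q, ENNReal.ofReal (u x) ≠ 0) (hU : ∫⁻ x in Q, ENNReal.ofReal (u x) ≠ ∞)
    (hW0 : ∫⁻ x in Q, ENNReal.ofReal (σ x) ≠ 0) (hW : ∫⁻ x in Q, ENNReal.ofReal (σ x) ≠ ∞) :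
    ∃ (m : ℕ) (A : ℝ≥0∞) (l : ℝ),
      A = volume Q ^ (α / n - 1) * (∫⁻ x in Q, ENNReal.ofReal (u x)) ^ (1 / q) *
        (∫⁻ x in Q, ENNReal.ofReal (σ x)) ^ (1 / p') ∧
      2 * κ * 2⁻¹ ^ (m + 1) ≤ A ∧ A ≤ 2 * κ * 2⁻¹ ^ m ∧ 0 < l ∧
      ∫⁻ x in Q, ENNReal.ofReal (logBump p' (p' - 1 + δ) (|σ x ^ (1 / p')| / l)) ≤ volume Q ∧
      ENNReal.ofReal l ^ p' * volume Q ≤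
        ENNReal.ofReal (2 ^ ((m + 1) * p')) * ∫⁻ x in Q, ENNReal.ofReal (σ x) := by
  have hp'0 : 0 < p' := hp'.symm.pos
  have hγ : 0 < p' - 1 + δ := by linarith [hp'.symm.lt]
  set V := volume Q with hVdef
  set U := ∫⁻ x in Q, ENNReal.ofReal (u x) with hUdef
  set W := ∫⁻ x in Q, ENNReal.ofReal (σ x) with hWdef
  set g := (V⁻¹ * W) ^ (1 / p') with hg
  set c := V ^ (α / n + 1 / q - 1 / p) * (V⁻¹ * U) ^ (1 / q) with hc
  have hVi0 : V⁻¹ ≠ 0 := ENNReal.inv_ne_zero.2 hV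
  have hVi : V⁻¹ ≠ ∞ := ENNReal.inv_ne_top.2 hV0
  have hg0 : g ≠ 0 := by
    rw [hg, Ne, ENNReal.rpow_eq_zero_iff_of_pos (by positivity)]
    exact mul_ne_zero hVi0 hW0
  have hgt : g ≠ ∞ := ENNReal.rpow_ne_top_of_nonneg (by positivity) (ENNReal.mul_ne_top hVi hW)
  have hc0 : c ≠ 0 := by
    refine mul_ne_zero (ENNReal.rpow_pos (pos_iff_ne_zero.2 hV0) hV).ne' ?_
    rw [Ne, ENNReal.rpow_eq_zero_iff_of_pos (by positivity)]
    exact mul_ne_zero hVi0 hU0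
  have hct : c ≠ ∞ := ENNReal.mul_ne_top (ENNReal.rpow_ne_top_of_ne_zero hV0 hV)
    (ENNReal.rpow_ne_top_of_nonneg (by positivity) (ENNReal.mul_ne_top hVi hU))
  have hA : c * g = V ^ (α / n - 1) * U ^ (1 / q) * W ^ (1 / p') := by
    rw [hc, hg, ENNReal.mul_rpow_of_nonneg _ _ (by positivity),
      ENNReal.mul_rpow_of_nonneg _ _ (by positivity), ← ENNReal.rpow_neg_one, ← ENNReal.rpow_mul,
      ← ENNReal.rpow_mul]
    have : V ^ (α / n - 1) = V ^ (α / n + 1 / q - 1 / p) * V ^ (-1 * (1 / q)) *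
        V ^ (-1 * (1 / p')) := by
      rw [← ENNReal.rpow_add _ _ hV0 hV, ← ENNReal.rpow_add _ _ hV0 hV]
      congr 1
      have := hp'.inv_add_inv_eq_one
      rw [one_div, one_div, one_div]
      linarith
    rw [this]
    ring
  have hbump : c * luxemburgNorm (logBump p' (p' - 1 + δ)) (fun x => σ x ^ (1 / p')) Q ≤ κ := by
    refine le_trans ?_ ((le_iSup₂ (f := fun (Q : Set (Fin n → ℝ)) (_ : IsCube Q) =>
      volume Q ^ (α / n + 1 / q - 1 / p) * avgNorm q (fun x => u x ^ (1 / q)) Q *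
        luxemburgNorm (logBump p' (p' - 1 + δ)) (fun x => σ x ^ (1 / p')) Q) Q hQ).trans hK)
    refine le_of_eq ?_
    have : avgNorm q (fun x => u x ^ (1 / q)) Q = (V⁻¹ * U) ^ (1 / q) := by
      unfold avgNorm cubeAvg
      congr 2
      refine lintegral_congr fun x => ?_
      have hux := hu.1 x
      rw [abs_of_nonneg (by positivity), ENNReal.ofReal_rpow_of_nonneg (by positivity) hq.le,
        ← Real.rpow_mul hux, one_div_mul_cancel hq.ne', Real.rpow_one]
    simp only [this, hc, hVdef]
  -- Doubling κ makes the inequality strict, so that an admissible `l` exists below the bound even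
  -- if the infimum is not attained.
  have hlux : luxemburgNorm (logBump p' (p' - 1 + δ)) (fun x => σ x ^ (1 / p')) Q < 2 * κ / c := by
    refine lt_of_le_of_lt ((ENNReal.le_div_iff_mul_le (Or.inl hc0) (Or.inl hct)).2
      (mul_comm c _ ▸ hbump)) ?_
    refine ENNReal.div_lt_div_right hc0 hct ?_
    rw [two_mul]
    exact ENNReal.lt_add_right hκ hκ0
  unfold luxemburgNorm at hlux
  simp only [iInf_lt_iff] at hlux
  obtain ⟨l, hl, hadm, hlc⟩ := hlux
  have hcl : c * ENNReal.ofReal l ≤ 2 * κ := by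
    rw [mul_comm]
    exact (ENNReal.le_div_iff_mul_le (Or.inl hc0) (Or.inl hct)).1 hlc.le
  have hint := cubeAvg_le_one hV0 hV hadm
  have hgl : g ≤ ENNReal.ofReal l := by
    have h1 := lintegral_le_of_logBump hσ.1 hp'0 hγ.le hl hint
    rw [hg, one_div, ENNReal.rpow_inv_le_iff hp'0, ← ENNReal.div_eq_inv_mul,
      ENNReal.div_le_iff hV0 hV]
    exact h1
  have hκ2 : 2 * κ ≠ ∞ := ENNReal.mul_ne_top (by norm_num) hκ
  obtain ⟨m, hm1, hm2⟩ := exists_inv_two_pow_near (A := c * g) (mul_ne_zero hc0 hg0) hκ2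
    ((mul_le_mul_right hgl c).trans hcl)
  refine ⟨m, c * g, l, hA, hm1, hm2, hl, hint, ?_⟩
  -- Since `c * l ≤ 2κ` while `c * g ≥ 2κ / 2 ^ (m + 1)`, the level m controls the ratio of bump
  -- norm to L^{p'} norm.
  have h1 : ENNReal.ofReal l ≤ 2 ^ (m + 1) * g := by
    have h2 : 2 * κ * (2⁻¹ ^ (m + 1) * ENNReal.ofReal l) ≤ 2 * κ * g := by
      calc 2 * κ * (2⁻¹ ^ (m + 1) * ENNReal.ofReal l)
          = 2 * κ * 2⁻¹ ^ (m + 1) * ENNReal.ofReal l := by ring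
        _ ≤ c * g * ENNReal.ofReal l := by gcongr
        _ = c * ENNReal.ofReal l * g := by ring
        _ ≤ _ := by gcongr
    rw [ENNReal.mul_le_mul_iff_right (mul_ne_zero two_ne_zero hκ0) hκ2, ← ENNReal.inv_pow,
      ← ENNReal.div_eq_inv_mul, ENNReal.div_le_iff (by positivity) (by finiteness)] at h2
    rwa [mul_comm]
  calc ENNReal.ofReal l ^ p' * V ≤ (2 ^ (m + 1) * g) ^ p' * V := by gcongr
    _ = ENNReal.ofReal (2 ^ ((m + 1) * p')) * (V * (V⁻¹ * W)) := by
        rw [ENNReal.mul_rpow_of_nonneg _ _ hp'0.le, hg, ← ENNReal.rpow_mul,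
          one_div_mul_cancel hp'0.ne', ENNReal.rpow_one,
          ← ENNReal.ofReal_rpow_of_pos (by norm_num), ENNReal.ofReal_ofNat, ENNReal.rpow_mul,
          ← Nat.cast_add_one, ENNReal.rpow_natCast]
        ring
    _ = _ := by rw [← mul_assoc V, ENNReal.mul_inv_cancel hV0 hV, one_mul]

/-! ### The testing estimate. -/

theorem lintegral_dyadicRiesz_le {α p q p' δ : ℝ} (hα : 0 < α) (hαn : α < n) (hp : 1 < p)
    (hpq : p < q) (hp' : p.HolderConjugate p') (hδ : 0 < δ) (hβ : 1 ≤ q / p * (1 - α / n)) :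
    ∃ C : ℝ≥0, C ≠ 0 ∧ ∀ u σ : (Fin n → ℝ) → ℝ, IsWeight u → IsWeight σ →
      ∀ κ : ℝ≥0∞, κ ≠ 0 → κ ≠ ∞ → bumpRight α p q p' δ u σ ≤ κ →
        ∀ D S : Set (Set (Fin n → ℝ)), IsDyadicGrid D → IsSparseSubset D S → ∀ R ∈ D,
          (∫⁻ x in R, dyadicRiesz α {Q | Q ∈ S ∧ Q ⊆ R}
            (R.indicator fun y => ENNReal.ofReal (σ y)) x ^ q * ENNReal.ofReal (u x)) ^ (1 / q) ≤
          C * κ * (∫⁻ x in R, ENNReal.ofReal (σ x)) ^ (1 / p) := by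
  have hn : n ≠ 0 := by
    rintro rfl
    simp only [Nat.cast_zero] at hαn
    linarith
  have hp0 : 0 < p := by linarith
  have hq0 : 0 < q := by linarith
  have hp'0 : 0 < p' := hp'.symm.pos
  have hγ : 0 < p' - 1 + δ := by linarith [hp'.symm.lt]
  set γ := p' - 1 + δ with hγdef
  obtain ⟨c, hc⟩ := exists_generation_count hp'0 hγ
  -- Ratio between consecutive levels: 1/2 from A_Q, against the q-th root of the growth of the
  -- Carleson constant.
  set ρ : ℝ≥0∞ := 2⁻¹ * (2 : ℝ≥0∞) ^ (p' / γ * (1 / q)) with hρ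
  have hρ1 : ρ < 1 := by
    have hexp : p' / γ * (1 / q) < 1 := by
      rw [div_mul_div_comm, mul_one, div_lt_one (by positivity)]
      have h1 : (p' - 1) * p = p' := by
        have := hp'.symm.mul_eq_add
        linarith
      have h2 : 0 < p' - 1 := by linarith [hp'.symm.lt]
      nlinarith
    calc ρ < 2⁻¹ * 2 ^ (1 : ℝ) := by
          rw [hρ]
          refine (ENNReal.mul_lt_mul_iff_right (by simp) (by simp)).2 ?_
          exact ENNReal.rpow_lt_rpow_of_exponent_lt (by norm_num) (by norm_num) hexp
      _ = 1 := by
          rw [ENNReal.rpow_one]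
          exact ENNReal.inv_mul_cancel (by norm_num) (by norm_num)
  have hgeom : ∀ ρ : ℝ≥0∞, ρ < 1 → ∑' k : ℕ, ρ ^ k ≠ ∞ := fun ρ h => by
    rw [ENNReal.tsum_geometric]
    exact ENNReal.inv_ne_top.2 (tsub_pos_of_lt h).ne'
  set C₁ : ℝ≥0∞ := 4 * (2 ^ q * 2 ^ (q / p)) ^ (1 / q) * ∑' k : ℕ, ((2⁻¹ : ℝ≥0∞) ^ (1 / q)) ^ k
    with hC₁
  set C₂ : ℝ≥0∞ := 2 * (4 * c) ^ (1 / q) * ∑' m : ℕ, ρ ^ m with hC₂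
  have hC₁t : C₁ ≠ ∞ := by
    refine ENNReal.mul_ne_top (by finiteness) (hgeom _ ?_)
    exact ENNReal.rpow_lt_one (by simp) (by positivity)
  have hC₂t : C₂ ≠ ∞ := ENNReal.mul_ne_top (by finiteness) (hgeom _ hρ1)
  refine ⟨(C₁ * C₂).toNNReal + 1, by positivity, ?_⟩
  intro u σ hu hσ κ hκ0 hκ hK D S hD hS R hR
  set ν := volume.withDensity fun x => ENNReal.ofReal (u x) with hν
  set τ := volume.withDensity fun x => ENNReal.ofReal (σ x) with hτ
  set T₀ := {Q | Q ∈ S ∧ Q ⊆ R} with hT₀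
  have htree₀ : IsSparseTree volume T₀ := hS.isSparseTree hn hD hR
  have hνQ : ∀ Q ∈ T₀, ν Q = ∫⁻ x in Q, ENNReal.ofReal (u x) := fun Q hQ =>
    withDensity_apply _ (htree₀.measurable Q hQ)
  have hτQ : ∀ Q ∈ T₀, τ Q = ∫⁻ x in Q, ENNReal.ofReal (σ x) := fun Q hQ =>
    withDensity_apply _ (htree₀.measurable Q hQ)
  have hcube : ∀ Q ∈ T₀, IsCube Q ∧ volume Q ≠ 0 ∧ volume Q ≠ ∞ ∧
      ∫⁻ x in Q, ENNReal.ofReal (u x) ≠ ∞ ∧ ∫⁻ x in Q, ENNReal.ofReal (σ x) ≠ ∞ := fun Q hQ => by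
    obtain ⟨k, a, rfl⟩ := hD.side Q (hS.1 hQ.1)
    refine ⟨⟨a, 2 ^ k, by positivity, rfl⟩, ?_, ?_, hu.lintegral_cube_ne_top _ _,
      hσ.lintegral_cube_ne_top _ _⟩
    · rw [volume_cube]
      exact pow_ne_zero _ (ENNReal.ofReal_pos.2 (by positivity)).ne'
    · rw [volume_cube]
      finiteness
  have hRm : MeasurableSet R := by
    obtain ⟨k, a, rfl⟩ := hD.side R hR
    exact measurableSet_cube _ _
  have hτR : τ R = ∫⁻ x in R, ENNReal.ofReal (σ x) := withDensity_apply _ hRm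
  -- The discarded cubes have zero coefficient or are ν-null; on the others A_Q is positive and has
  -- a level.
  set T := {Q | Q ∈ T₀ ∧ τ Q ≠ 0 ∧ ν Q ≠ 0} with hT
  have hTT₀ : T ⊆ T₀ := fun Q hQ => hQ.1
  have htree : IsSparseTree volume T := htree₀.mono hTT₀
  set a : Set (Fin n → ℝ) → ℝ≥0∞ := fun Q => volume Q ^ (α / n) * ((volume Q)⁻¹ * τ Q) with ha
  have hriesz : ∀ x, dyadicRiesz α T₀ (R.indicator fun y => ENNReal.ofReal (σ y)) x =
      ∑' Q : T₀, (Q : Set (Fin n → ℝ)).indicator (fun _ => a Q) x := fun x => by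
    refine tsum_congr fun Q => ?_
    simp only [ha, cubeAvg, hτQ Q Q.2]
    rw [setLIntegral_congr_fun (g := fun y => ENNReal.ofReal (σ y))
      (htree₀.measurable Q Q.2) fun y hy => indicator_of_mem (Q.2.2 hy) _]
  have hae : ∀ᵐ x ∂ν, ∑' Q : T₀, (Q : Set (Fin n → ℝ)).indicator (fun _ => a Q) x ≤
      ∑' Q : T, (Q : Set (Fin n → ℝ)).indicator (fun _ => a Q) x := by
    have h1 : ∀ᵐ x ∂ν, ∀ Q ∈ T₀, ν Q = 0 → x ∉ Q := by
      rw [ae_ball_iff htree₀.countable]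
      intro Q hQ
      by_cases h0 : ν Q = 0
      · filter_upwards [measure_eq_zero_iff_ae_notMem.1 h0] with x hx _ using hx
      · exact Filter.Eventually.of_forall fun x h => absurd h h0
    filter_upwards [h1] with x hx
    rw [tsum_subtype T₀ fun Q => Q.indicator (fun _ => a Q) x,
      tsum_subtype T fun Q => Q.indicator (fun _ => a Q) x]
    refine ENNReal.tsum_le_tsum fun Q => ?_
    by_cases hQ₀ : Q ∈ T₀
    · by_cases hQ : Q ∈ T
      · simp [hQ, hQ₀]
      · rw [indicator_of_mem hQ₀]
        by_cases h0 : τ Q = 0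
        · simp [ha, h0]
        · have h0' : ν Q = 0 := by
            by_contra h
            exact hQ ⟨hQ₀, h0, h⟩
          simp [hx Q hQ₀ h0']
    · simp [hQ₀]
  have hkey : ∀ Q, ∃ m : ℕ, Q ∈ T → ∃ (A : ℝ≥0∞) (l : ℝ),
      A = volume Q ^ (α / n - 1) * ν Q ^ (1 / q) * τ Q ^ (1 / p') ∧
      2 * κ * 2⁻¹ ^ (m + 1) ≤ A ∧ A ≤ 2 * κ * 2⁻¹ ^ m ∧ 0 < l ∧
      ∫⁻ x in Q, ENNReal.ofReal (logBump p' γ (|σ x ^ (1 / p')| / l)) ≤ volume Q ∧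
      ENNReal.ofReal l ^ p' * volume Q ≤ ENNReal.ofReal (2 ^ ((m + 1) * p')) * τ Q := fun Q => by
    by_cases hQ : Q ∈ T
    · obtain ⟨hQc, hV0, hV, hU, hW⟩ := hcube Q hQ.1
      have hW0 := hQ.2.1
      have hU0 := hQ.2.2
      rw [hνQ Q hQ.1] at *
      rw [hτQ Q hQ.1] at *
      obtain ⟨m, h⟩ := exists_admissible_of_bumpRight_le hq0 hp' hδ hu hσ hκ0 hκ hK hQc hV0 hV
        hU0 hU hW0 hW
      exact ⟨m, fun _ => h⟩
    · exact ⟨0, fun h => absurd h hQ⟩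
  choose m hm using hkey
  have hid1 : ∀ Q ∈ T, a Q ^ q * ν Q = (volume Q ^ (α / n - 1) * ν Q ^ (1 / q) *
      τ Q ^ (1 / p')) ^ q * τ Q ^ (q / p) := fun Q hQ => by
    obtain ⟨hQc, hV0, hV, hU, hW⟩ := hcube Q hQ.1
    exact riesz_rpow_mul_eq hq0 hp' hV0 hV hQ.2.1 (hτQ Q hQ.1 ▸ hW)
  have hid2 : ∀ Q ∈ T, τ Q ^ (q / p) = a Q ^ (q / p) * volume Q ^ (q / p * (1 - α / n)) :=
    fun Q hQ => by
    obtain ⟨hQc, hV0, hV, hU, hW⟩ := hcube Q hQ.1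
    rw [mul_comm (q / p)]
    exact rpow_eq_riesz_rpow_mul (by positivity) hV0 hV
  have hlevel : ∀ i : ℕ, (∑' Q : {Q | Q ∈ T ∧ m Q = i}, a Q ^ q * ν Q) ^ (1 / q) ≤
      2 * κ * (4 * c) ^ (1 / q) * τ R ^ (1 / p) * ρ ^ i := fun i => by
    set Ti := {Q | Q ∈ T ∧ m Q = i} with hTi
    have htreei : IsSparseTree volume Ti := htree.mono fun Q hQ => hQ.1
    obtain ⟨j, N, hj0, hjc, hN, hNB, hjN⟩ := hc i
    have hqp : 0 ≤ q / p - 1 := by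
      rw [sub_nonneg, one_le_div hp0]
      exact hpq.le
    have hcarl : ∑' Q : Ti, τ Q ≤ 4 * j * τ R := by
      refine htreei.tsum_measure_le τ (fun Q hQ => hQ.1.1.2) hj0 ?_
      rintro Q ⟨hQ, rfl⟩ E hEQ hEm hE
      obtain ⟨A, l, -, -, -, hl, hint, hlB⟩ := hm Q hQ
      rw [hτQ Q hQ.1] at hlB ⊢
      rw [hτ, withDensity_apply _ hEm]
      exact lintegral_le_three_quarters_of_logBump hσ.1 hp'0 hγ hl hN (by positivity) hNB hjN
        hEQ hE hint hlB
    have hsum : ∑' Q : Ti, a Q ^ q * ν Q ≤ (2 * κ * 2⁻¹ ^ i) ^ q *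
        (4 * (c * 2 ^ (i * (p' / γ))) * τ R ^ (q / p)) := by
      calc ∑' Q : Ti, a Q ^ q * ν Q
          ≤ ∑' Q : Ti, (2 * κ * 2⁻¹ ^ i) ^ q * (τ R ^ (q / p - 1) * τ Q) := by
            refine ENNReal.tsum_le_tsum ?_
            rintro ⟨Q, hQ, rfl⟩
            obtain ⟨A, l, hA, -, hA2, -⟩ := hm Q hQ
            rw [hid1 Q hQ, ← hA]
            gcongr
            calc τ Q ^ (q / p) = τ Q ^ (q / p - 1) * τ Q ^ (1 : ℝ) := by
                  rw [← ENNReal.rpow_add_of_nonneg _ _ hqp zero_le_one, sub_add_cancel]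
              _ ≤ _ := by
                  rw [ENNReal.rpow_one]
                  gcongr
                  exact hQ.1.2
        _ = (2 * κ * 2⁻¹ ^ i) ^ q * (τ R ^ (q / p - 1) * ∑' Q : Ti, τ Q) := by
            rw [ENNReal.tsum_mul_left, ENNReal.tsum_mul_left]
        _ ≤ (2 * κ * 2⁻¹ ^ i) ^ q * (τ R ^ (q / p - 1) *
              (4 * (c * 2 ^ (i * (p' / γ))) * τ R)) := by
            gcongr
            exact hcarl.trans (by gcongr)
        _ = _ := by
            have : τ R ^ (q / p) = τ R ^ (q / p - 1) * τ R := by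
              conv_rhs => rw [← ENNReal.rpow_one (τ R), ← ENNReal.rpow_mul, one_mul,
                ← ENNReal.rpow_add_of_nonneg _ _ hqp zero_le_one, sub_add_cancel]
            rw [this]
            ring
    have hq' : 0 ≤ 1 / q := by positivity
    calc _ ≤ ((2 * κ * 2⁻¹ ^ i) ^ q *
            (4 * (c * 2 ^ (i * (p' / γ))) * τ R ^ (q / p))) ^ (1 / q) := by gcongr
      _ = 2 * κ * 2⁻¹ ^ i * ((4 * c) ^ (1 / q) * ((2 : ℝ≥0∞) ^ (i * (p' / γ))) ^ (1 / q) *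
            (τ R ^ (q / p)) ^ (1 / q)) := by
          rw [← mul_assoc 4, ENNReal.mul_rpow_of_nonneg _ _ hq', ENNReal.mul_rpow_of_nonneg _ _ hq',
            ENNReal.mul_rpow_of_nonneg (4 * (c : ℝ≥0∞)) _ hq', ← ENNReal.rpow_mul _ q,
            mul_one_div_cancel hq0.ne', ENNReal.rpow_one]
      _ = _ := by
          have h1 : (τ R ^ (q / p)) ^ (1 / q) = τ R ^ (1 / p) := by
            rw [← ENNReal.rpow_mul]
            congr 1
            field_simp
          have h2 : ((2 : ℝ≥0∞) ^ (i * (p' / γ))) ^ (1 / q) =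
              ((2 : ℝ≥0∞) ^ (p' / γ * (1 / q))) ^ i := by
            rw [← ENNReal.rpow_mul, ← ENNReal.rpow_natCast, ← ENNReal.rpow_mul]
            congr 1
            ring
          rw [h1, h2, hρ, mul_pow]
          ring
  calc _ ≤ (∫⁻ x, (∑' Q : T, (Q : Set (Fin n → ℝ)).indicator (fun _ => a Q) x) ^ q ∂ν) ^
        (1 / q) := by
        refine ENNReal.rpow_le_rpow ?_ (by positivity)
        have : Countable T₀ := htree₀.countable.to_subtype
        have hmeas : Measurable fun x => (∑' Q : T₀,
            (Q : Set (Fin n → ℝ)).indicator (fun _ => a Q) x) ^ q :=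
          (Measurable.tsum fun Q : T₀ =>
            measurable_const.indicator (htree₀.measurable Q Q.2)).pow_const q
        calc _ ≤ ∫⁻ x, (∑' Q : T₀, (Q : Set (Fin n → ℝ)).indicator (fun _ => a Q) x) ^ q *
              ENNReal.ofReal (u x) := by
              simp_rw [hriesz]
              exact setLIntegral_le_lintegral _ _
          _ = ∫⁻ x, (∑' Q : T₀, (Q : Set (Fin n → ℝ)).indicator (fun _ => a Q) x) ^ q ∂ν := by
              rw [hν, lintegral_withDensity_eq_lintegral_mul₀
                hu.2.aestronglyMeasurable.aemeasurable.ennreal_ofReal hmeas.aemeasurable]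
              refine lintegral_congr fun x => ?_
              rw [Pi.mul_apply, mul_comm]
          _ ≤ _ := by
              refine lintegral_mono_ae ?_
              filter_upwards [hae] with x hx
              gcongr
    _ ≤ C₁ * ∑' i, (∑' Q : {Q | Q ∈ T ∧ m Q = i}, a Q ^ q * ν Q) ^ (1 / q) := by
        -- Here `y i` is the q-th power of the lower end of level i; the upper end is twice as
        -- large, whence the comparison constant 2^q.
        refine htree.lintegral_tsum_rpow_le ν (y := fun i => (2 * κ * 2⁻¹ ^ (i + 1)) ^ q)
          (by linarith) (by positivity) hβ ?_ ?_ ?_ ?_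
        · intro Q hQ
          obtain ⟨hQc, hV0, hV, hU, hW⟩ := hcube Q hQ.1
          exact mul_ne_zero (ENNReal.rpow_pos (pos_iff_ne_zero.2 hV0) hV).ne'
            (mul_ne_zero (ENNReal.inv_ne_zero.2 hV) hQ.2.1)
        · intro Q hQ
          obtain ⟨hQc, hV0, hV, hU, hW⟩ := hcube Q hQ.1
          exact ENNReal.mul_ne_top (ENNReal.rpow_ne_top_of_ne_zero hV0 hV)
            (ENNReal.mul_ne_top (ENNReal.inv_ne_top.2 hV0) (hτQ Q hQ.1 ▸ hW))
        · intro Q hQ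
          obtain ⟨A, l, hA, hA1, -⟩ := hm Q hQ
          rw [hid1 Q hQ, hid2 Q hQ, ← hA]
          gcongr
        · intro Q hQ
          obtain ⟨A, l, hA, -, hA2, -⟩ := hm Q hQ
          rw [hid1 Q hQ, hid2 Q hQ, ← hA, ← mul_assoc ((2 : ℝ≥0∞) ^ q), ← ENNReal.mul_rpow_of_nonneg _ _ hq0.le]
          gcongr
          refine hA2.trans (le_of_eq ?_)
          calc 2 * κ * 2⁻¹ ^ m Q = 2 * 2⁻¹ * (2 * κ * 2⁻¹ ^ m Q) := by
                rw [ENNReal.mul_inv_cancel (by norm_num) (by norm_num), one_mul]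
            _ = _ := by ring
    _ ≤ C₁ * ∑' i, 2 * κ * (4 * c) ^ (1 / q) * τ R ^ (1 / p) * ρ ^ i := by
        gcongr with i
        exact hlevel i
    _ = C₁ * C₂ * κ * τ R ^ (1 / p) := by
        rw [ENNReal.tsum_mul_left, hC₂]
        ring
    _ ≤ _ := by
        rw [hτR]
        gcongr
        rw [ENNReal.coe_add, ENNReal.coe_toNNReal (ENNReal.mul_ne_top hC₁t hC₂t)]
        exact le_self_add

/-- The levels need a positive finite majorant κ, so the bound is proved for every κ above the bump
constant, which may be 0, and κ is then lowered to it. -/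
theorem testingConst_le_bumpRight {α p q p' δ : ℝ} (hα : 0 < α) (hαn : α < n) (hp : 1 < p)
    (hpq : p < q) (hp' : p.HolderConjugate p') (hδ : 0 < δ) (hβ : 1 ≤ q / p * (1 - α / n)) :
    ∃ C : ℝ≥0, ∀ u σ : (Fin n → ℝ) → ℝ, IsWeight u → IsWeight σ →
      ∀ D S : Set (Set (Fin n → ℝ)), IsDyadicGrid D → IsSparseSubset D S →
        testingConst α D S u σ p q ≤ C * bumpRight α p q p' δ u σ := by
  have hp0 : 0 < p := by linarith
  obtain ⟨C, hC0, hC⟩ := lintegral_dyadicRiesz_le hα hαn hp hpq hp' hδ hβ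
  have hC0' : (C : ℝ≥0∞) ≠ 0 := ENNReal.coe_ne_zero.2 hC0
  refine ⟨C, fun u σ hu hσ D S hD hS => ?_⟩
  rw [mul_comm, ← ENNReal.div_le_iff hC0' ENNReal.coe_ne_top]
  refine le_of_forall_gt_imp_ge_of_dense fun κ hκ => ?_
  rw [ENNReal.div_le_iff hC0' ENNReal.coe_ne_top, mul_comm]
  rcases eq_or_ne κ ∞ with rfl | hκt
  · simp [ENNReal.mul_top hC0']
  refine iSup₂_le fun R hR => ?_
  have hmain := hC u σ hu hσ κ (zero_le.trans_lt hκ).ne' hκt hκ.le D S hD hS R hR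
  set W := ∫⁻ x in R, ENNReal.ofReal (σ x) with hW
  have hWt : W ≠ ∞ := by
    obtain ⟨k, a, rfl⟩ := hD.side R hR
    exact hσ.lintegral_cube_ne_top _ _
  -- When σ(R) = 0 the negative power is ∞, but the main bound makes the other factor 0.
  rcases eq_or_ne W 0 with h0 | h0
  · rw [h0, ENNReal.zero_rpow_of_pos (by positivity), mul_zero] at hmain
    rw [le_antisymm hmain zero_le, mul_zero]
    exact zero_le
  · calc _ ≤ W ^ (-(1 / p)) * (C * κ * W ^ (1 / p)) := by gcongr
      _ = C * κ * (W ^ (-(1 / p)) * W ^ (1 / p)) := by ring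
      _ = C * κ := by
        rw [← ENNReal.rpow_add _ _ h0 hWt, neg_add_cancel, ENNReal.rpow_zero, mul_one]

/-! ### Duality and the theorem. -/

/-- The exponent of |Q| is invariant under duality because 1/q - 1/p = 1/p' - 1/q'. -/
theorem bumpLeft_eq_bumpRight {α p q p' q' δ : ℝ} (hp' : p.HolderConjugate p')
    (hq' : q.HolderConjugate q') (u σ : (Fin n → ℝ) → ℝ) :
    bumpLeft α p q p' δ u σ = bumpRight α q' p' q δ σ u := by
  have h : α / n + 1 / q - 1 / p = α / n + 1 / p' - 1 / q' := by
    have h1 := hp'.inv_add_inv_eq_one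
    have h2 := hq'.inv_add_inv_eq_one
    simp only [one_div]
    linarith
  unfold bumpLeft bumpRight
  refine iSup_congr fun Q => iSup_congr fun _ => ?_
  rw [h, mul_right_comm]

end Cubes

theorem mainTheorem8 (n : ℕ) (α p q p' q' δ : ℝ) (hα : 0 < α) (hαn : α < n)
    (hp : 1 < p) (hpq : p < q) (hp' : p.HolderConjugate p') (hq' : q.HolderConjugate q')
    (hδ : 0 < δ) :
    (1 ≤ p' / q' * (1 - α / n) →
      ∃ C : ℝ≥0, ∀ u σ : (Fin n → ℝ) → ℝ, IsWeight u → IsWeight σ →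
        bumpLeft α p q p' δ u σ < ∞ →
        ∀ D S : Set (Set (Fin n → ℝ)), IsDyadicGrid D → IsSparseSubset D S →
          testingConst α D S σ u q' p' ≤ C * bumpLeft α p q p' δ u σ) ∧
    (1 ≤ q / p * (1 - α / n) →
      ∃ C : ℝ≥0, ∀ u σ : (Fin n → ℝ) → ℝ, IsWeight u → IsWeight σ →
        bumpRight α p q p' δ u σ < ∞ →
        ∀ D S : Set (Set (Fin n → ℝ)), IsDyadicGrid D → IsSparseSubset D S →
          testingConst α D S u σ p q ≤ C * bumpRight α p q p' δ u σ) := by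
  constructor
  · intro hβ
    have hqp : q' < p' := by
      have h1 := hp'.inv_add_inv_eq_one
      have h2 := hq'.inv_add_inv_eq_one
      have h3 : q⁻¹ < p⁻¹ := (inv_lt_inv₀ (by linarith) (by linarith)).2 hpq
      exact (inv_lt_inv₀ hp'.symm.pos hq'.symm.pos).1 (by linarith)
    obtain ⟨C, hC⟩ := testingConst_le_bumpRight hα hαn hq'.symm.lt hqp hq'.symm hδ hβ
    refine ⟨C, fun u σ hu hσ _ D S hD hS => ?_⟩
    rw [bumpLeft_eq_bumpRight hp' hq']
    exact hC σ u hσ hu D S hD hS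
  · intro hβ
    obtain ⟨C, hC⟩ := testingConst_le_bumpRight hα hαn hp hpq hp' hδ hβ
    exact ⟨C, fun u σ hu hσ _ D S hD hS => hC u σ hu hσ D S hD hS⟩
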